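/- Let $D^{2,2,2}$ be the modular lattice with unity $I$ presented by the generators $x_1,y_1,x_2,y_2,x_3,y_3$ and the relations $x_i\subseteq y_i$ $(i=1,2,3)$; sum and intersection are written $a+b$ and $ab$. *Atomic elements.* For $\{i,j,k\}=\{1,2,3\}$ put $a_0^{ij}=A_0^{ij}=I$ and, for $n\ge 1$, $a_n^{ij}=x_i+y_j\,a_{n-1}^{jk}$, $\;A_n^{ij}=y_i+x_j\,A_{n-1}^{ki}$. *Admissible elements.* To the following index sequences $\alpha$ with rightmost index $1$ associate elements $f_\alpha\subseteq e_\alpha$. Here $\gamma=(213)^{2p}(21)^{2k}$ with $k>0,\ p\ge 0$, $\;\beta=(213)^{2p}(21)^{2k+1}$ with $k,p\ge 0$, in types 7 and 8 $k\ge 0$, and $q=k+3p$. $$\begin{array}{r|l|l|l} & \alpha & f_\alpha & e_\alpha\\ \hline 1&\gamma & y_1y_2a^{13}_qA^{32}_{k-1} & y_2A^{32}_{k-1}a^{21}_qA^{13}_ka^{13}_q\\ 2&3\gamma & y_3(x_1+x_2)A^{23}_qa^{31}_{k-1} & y_3a^{31}_{k-1}A^{12}_{q+1}a^{12}_kA^{23}_q\\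 3&13\gamma & y_3y_1a^{32}_{q+1}A^{21}_{k-1} & y_1A^{21}_{k-1}a^{13}_{q+1}A^{32}_ka^{32}_{q+1}\\ 4&(213)\gamma & y_2(x_3+x_1)A^{12}_{q+1}a^{23}_{k-1} & y_2a^{23}_{k-1}A^{31}_{q+2}a^{31}_kA^{12}_{q+1}\\ 5&3(213)\gamma & y_2y_3a^{21}_{q+2}A^{13}_{k-1} & y_3A^{13}_{k-1}a^{32}_{q+2}A^{21}_ka^{21}_{q+2}\\ 6&13(213)\gamma & y_1(x_2+x_3)A^{31}_{q+2}a^{12}_{k-1} & y_1a^{12}_{k-1}A^{23}_{q+3}a^{23}_kA^{31}_{q+2}\\ 7&1(21)^{2k} & x_1A^{23}_ka^{23}_k & y_1A^{31}_ka^{12}_kA^{23}_ka^{23}_k\\ 8&1(21)^{2k+1} & y_1(x_2+x_3)A^{31}_ka^{12}_k & y_1A^{31}_ka^{12}_kA^{23}_{k+1}a^{23}_{k+1}\\ 9&\beta & y_2y_3a^{21}_qA^{13}_k & y_2A^{32}_ka^{21}_qA^{13}_ka^{13}_{q+1}\\ 10&3\beta & x_3A^{12}_{q+1}a^{12}_k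 & y_3a^{31}_kA^{12}_{q+1}a^{12}_kA^{23}_{q+1}\\ 11&13\beta & y_1y_2a^{13}_{q+1}A^{32}_k & y_1A^{21}_ka^{13}_{q+1}A^{32}_ka^{32}_{q+2}\\ 12&(213)\beta & x_2A^{31}_{q+2}a^{31}_k & y_2a^{23}_kA^{31}_{q+2}a^{31}_kA^{12}_{q+2}\\ 13&3(213)\beta & y_3y_1a^{32}_{q+2}A^{21}_k & y_3A^{13}_ka^{32}_{q+2}A^{21}_ka^{21}_{q+3}\\ 14&13(213)\beta & x_1A^{23}_{q+3}a^{23}_k & y_1a^{12}_kA^{23}_{q+3}a^{23}_kA^{31}_{q+3} \end{array}$$ The remaining admissible sequences and their elements arise from these by permuting the indices $1,2,3$ simultaneously in $\alpha$ and in the polynomials. *Cumulative elements.* For $n\ge 1$ and $t=1,2,3$, let $x_t(n)=\sum f_\alpha$ and $y_t(n)=\sum e_\alpha$, the sums over all these admissible sequences $\alpha$ of length $n$ with rightmost index $t$. *The lattices $H^+(n)$.* For $\{i,j,k\}=\{1,2,3\}$ put $$a_i(0)=y_j+y_k,\qquad b_i(0)=x_i+y_j+y_k,\qquad c_i(0)=y_1+y_2+y_3,$$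 and, for $n\ge 1$, $$a_i(n)=x_j(n)+x_k(n)+y_j(n+1)+y_k(n+1),\quad b_i(n)=a_i(n)+x_i(n+1),\quad c_i(n)=a_i(n)+y_i(n+1).$$ Let $H^+(0)$ be the sublattice of $D^{2,2,2}$ generated by the elements $a_i(0)\subseteq b_i(0)$ $(i=1,2,3)$, and for $n\ge 1$ let $H^+(n)$ be the sublattice generated by the elements $a_i(n)\subseteq b_i(n)\subseteq c_i(n)$ $(i=1,2,3)$. Put $I_n=a_1(n)+a_2(n)+a_3(n)$. **Statement.** 1. $H^+(n)$ is a distributive lattice for every $n\ge 0$. 2. For every $n\ge 1$, $H^+(n)$ has exactly $64$ elements. For each $i$ the chain $a_i(n)\subset b_i(n)\subset c_i(n)\subset I_n$ has four distinct elements, and $H^+(n)$ is the direct product of these three $4$-element chains: $(v_1,v_2,v_3)\mapsto v_1v_2v_3$ is a lattice isomorphism from the product of the chains onto $H^+(n)$. 3. $H^+(0)$ has exactly $27$ elements. For each $i$ the chain $a_i(0)\subset b_i(0)\subset c_i(0)$ has three distinct elements, and $(v_1,v_2,v_3)\mapsto v_1v_2v_3$ is a lattice isomorphism from the product of these three chains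 onto $H^+(0)$. -/

import Mathlib

/-! The modular lattice `D^{2,2,2}`: the modular lattice with unity `I = ⊤` that is presented by the
generators `x_i`, `y_i` and the relations `x_i ⊆ y_i`, for `i = 1, 2, 3`.  The index set `{1, 2, 3}`
is `Fin 3`.  Sum and intersection are `⊔` and `⊓`. -/

namespace D222

/-- Lattice polynomials in `x_i`, `y_i` and the unity. -/
inductive Poly : Type
  | x : Fin 3 → Poly
  | y : Fin 3 → Poly
  | one : Poly
  | sum : Poly → Poly → Poly
  | inter : Poly → Poly → Poly

/-- The inclusions between polynomials that follow from the axioms of modular lattices with unity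
and from `x_i ⊆ y_i`. -/
inductive Poly.Le : Poly → Poly → Prop
  | refl (s : Poly) : Poly.Le s s
  | trans {s t u : Poly} : Poly.Le s t → Poly.Le t u → Poly.Le s u
  | left_sum (s t : Poly) : Poly.Le s (.sum s t)
  | right_sum (s t : Poly) : Poly.Le t (.sum s t)
  | sum_le {s t u : Poly} : Poly.Le s u → Poly.Le t u → Poly.Le (.sum s t) u
  | inter_left (s t : Poly) : Poly.Le (.inter s t) s
  | inter_right (s t : Poly) : Poly.Le (.inter s t) t
  | le_inter {s t u : Poly} : Poly.Le s t → Poly.Le s u → Poly.Le s (.inter t u)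
  | le_one (s : Poly) : Poly.Le s .one
  | modular {s u : Poly} (t : Poly) : Poly.Le s u →
      Poly.Le (.inter (.sum s t) u) (.sum s (.inter t u))
  | x_le_y (i : Fin 3) : Poly.Le (.x i) (.y i)

/-- Two polynomials are identified if each is included in the other. -/
instance polySetoid : Setoid Poly where
  r s t := Poly.Le s t ∧ Poly.Le t s
  iseqv :=
    { refl := fun s => ⟨.refl s, .refl s⟩
      symm := fun h => ⟨h.2, h.1⟩
      trans := fun h h' => ⟨h.1.trans h'.1, h'.2.trans h.2⟩ }

end D222

/-- The modular lattice `D^{2,2,2}`. -/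
def D222 : Type := Quotient D222.polySetoid

namespace D222

instance : Lattice D222 where
  le := Quotient.lift₂ Poly.Le fun _ _ _ _ h h' =>
    propext ⟨fun k => (h.2.trans k).trans h'.1, fun k => (h.1.trans k).trans h'.2⟩
  le_refl := by rintro ⟨s⟩; exact Poly.Le.refl s
  le_trans := by rintro ⟨s⟩ ⟨t⟩ ⟨u⟩ h h'; exact Poly.Le.trans h h'
  le_antisymm := by rintro ⟨s⟩ ⟨t⟩ h h'; exact Quotient.sound ⟨h, h'⟩
  sup := Quotient.map₂ Poly.sum fun s t h s' t' h' =>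
    ⟨.sum_le (h.1.trans (.left_sum t t')) (h'.1.trans (.right_sum t t')),
      .sum_le (h.2.trans (.left_sum s s')) (h'.2.trans (.right_sum s s'))⟩
  le_sup_left := by rintro ⟨s⟩ ⟨t⟩; exact Poly.Le.left_sum s t
  le_sup_right := by rintro ⟨s⟩ ⟨t⟩; exact Poly.Le.right_sum s t
  sup_le := by rintro ⟨s⟩ ⟨t⟩ ⟨u⟩ h h'; exact Poly.Le.sum_le h h'
  inf := Quotient.map₂ Poly.inter fun s t h s' t' h' =>
    ⟨.le_inter ((Poly.Le.inter_left s s').trans h.1) ((Poly.Le.inter_right s s').trans h'.1),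
      .le_inter ((Poly.Le.inter_left t t').trans h.2) ((Poly.Le.inter_right t t').trans h'.2)⟩
  inf_le_left := by rintro ⟨s⟩ ⟨t⟩; exact Poly.Le.inter_left s t
  inf_le_right := by rintro ⟨s⟩ ⟨t⟩; exact Poly.Le.inter_right s t
  le_inf := by rintro ⟨s⟩ ⟨t⟩ ⟨u⟩ h h'; exact Poly.Le.le_inter h h'

instance : IsModularLattice D222 where
  sup_inf_le_assoc_of_le := by
    rintro ⟨s⟩ ⟨t⟩ ⟨u⟩ h
    exact Poly.Le.modular t h

instance : OrderTop D222 where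
  top := Quotient.mk _ Poly.one
  le_top := by rintro ⟨s⟩; exact Poly.Le.le_one s

/-- The generators `x_i`. -/
def x (i : Fin 3) : D222 := Quotient.mk _ (Poly.x i)

/-- The generators `y_i`. -/
def y (i : Fin 3) : D222 := Quotient.mk _ (Poly.y i)

theorem x_le_y (i : Fin 3) : x i ≤ y i := Poly.Le.x_le_y i

/-- `x_1 x_2 x_3` is the least element, because it lies below every generator.  This is only used in
order to write finite sums as `Finset.sup`; all the sums below are over nonempty sets. -/
instance : OrderBot D222 where
  bot := x 0 ⊓ x 1 ⊓ x 2
  bot_le := by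
    have hx : ∀ i, x 0 ⊓ x 1 ⊓ x 2 ≤ x i := by
      intro i
      fin_cases i
      · exact inf_le_left.trans inf_le_left
      · exact inf_le_left.trans inf_le_right
      · exact inf_le_right
    rintro ⟨s⟩
    induction s with
    | x i => exact hx i
    | y i => exact (hx i).trans (x_le_y i)
    | one => exact le_top
    | sum s t hs ht => exact Poly.Le.trans hs (Poly.Le.left_sum s t)
    | inter s t hs ht => exact Poly.Le.le_inter hs ht

/-- For distinct `i`, `j`, the index `k` such that `{i, j, k}` is the whole index set. -/
def third (i j : Fin 3) : Fin 3 := -(i + j)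

/-- The atomic elements `a_n^{ij}`: `a_0^{ij} = I` and `a_n^{ij} = x_i + y_j a_{n-1}^{jk}`. -/
def a : ℕ → Fin 3 → Fin 3 → D222
  | 0, _, _ => ⊤
  | n + 1, i, j => x i ⊔ y j ⊓ a n j (third i j)

/-- The atomic elements `A_n^{ij}`: `A_0^{ij} = I` and `A_n^{ij} = y_i + x_j A_{n-1}^{ki}`. -/
def A : ℕ → Fin 3 → Fin 3 → D222
  | 0, _, _ => ⊤
  | n + 1, i, j => y i ⊔ x j ⊓ A n (third i j) i

/-- `w` repeated `m` times. -/
def rep (m : ℕ) (w : List (Fin 3)) : List (Fin 3) := (List.replicate m w).flatten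

/-- The sequence `γ = (jil)^{2p} (ji)^{2k}`, which is `(213)^{2p} (21)^{2k}` for `i, j, l = 1, 2, 3`. -/
def gam (i j l : Fin 3) (k p : ℕ) : List (Fin 3) := rep (2 * p) [j, i, l] ++ rep (2 * k) [j, i]

/-- The sequence `β = (jil)^{2p} (ji)^{2k+1}`, which is `(213)^{2p} (21)^{2k+1}` for
`i, j, l = 1, 2, 3`. -/
def bet (i j l : Fin 3) (k p : ℕ) : List (Fin 3) := rep (2 * p) [j, i, l] ++ rep (2 * k + 1) [j, i]

/-- The fourteen types of admissible sequences that start (at the right end) with `i`; the indices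
`1, 2, 3` of the table are replaced by `i, j, l`. -/
def adm (i j l : Fin 3) (k p : ℕ) : Fin 14 → List (Fin 3) :=
  ![gam i j l k p,
    l :: gam i j l k p,
    i :: l :: gam i j l k p,
    j :: i :: l :: gam i j l k p,
    l :: j :: i :: l :: gam i j l k p,
    i :: l :: j :: i :: l :: gam i j l k p,
    i :: rep (2 * k) [j, i],
    i :: rep (2 * k + 1) [j, i],
    bet i j l k p,
    l :: bet i j l k p,
    i :: l :: bet i j l k p,
    j :: i :: l :: bet i j l k p,
    l :: j :: i :: l :: bet i j l k p,
    i :: l :: j :: i :: l :: bet i j l k p]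

/-- The admissible elements `f_α`, for `α = adm i j l k p r`; here `q = k + 3 p`. -/
def f (i j l : Fin 3) (k p : ℕ) : Fin 14 → D222 :=
  let q := k + 3 * p
  ![y i ⊓ y j ⊓ a q i l ⊓ A (k - 1) l j,
    y l ⊓ (x i ⊔ x j) ⊓ A q j l ⊓ a (k - 1) l i,
    y l ⊓ y i ⊓ a (q + 1) l j ⊓ A (k - 1) j i,
    y j ⊓ (x l ⊔ x i) ⊓ A (q + 1) i j ⊓ a (k - 1) j l,
    y j ⊓ y l ⊓ a (q + 2) j i ⊓ A (k - 1) i l,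
    y i ⊓ (x j ⊔ x l) ⊓ A (q + 2) l i ⊓ a (k - 1) i j,
    x i ⊓ A k j l ⊓ a k j l,
    y i ⊓ (x j ⊔ x l) ⊓ A k l i ⊓ a k i j,
    y j ⊓ y l ⊓ a q j i ⊓ A k i l,
    x l ⊓ A (q + 1) i j ⊓ a k i j,
    y i ⊓ y j ⊓ a (q + 1) i l ⊓ A k l j,
    x j ⊓ A (q + 2) l i ⊓ a k l i,
    y l ⊓ y i ⊓ a (q + 2) l j ⊓ A k j i,
    x i ⊓ A (q + 3) j l ⊓ a k j l]

/-- The admissible elements `e_α`, for `α = adm i j l k p r`; here `q = k + 3 p`. -/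
def e (i j l : Fin 3) (k p : ℕ) : Fin 14 → D222 :=
  let q := k + 3 * p
  ![y j ⊓ A (k - 1) l j ⊓ a q j i ⊓ A k i l ⊓ a q i l,
    y l ⊓ a (k - 1) l i ⊓ A (q + 1) i j ⊓ a k i j ⊓ A q j l,
    y i ⊓ A (k - 1) j i ⊓ a (q + 1) i l ⊓ A k l j ⊓ a (q + 1) l j,
    y j ⊓ a (k - 1) j l ⊓ A (q + 2) l i ⊓ a k l i ⊓ A (q + 1) i j,
    y l ⊓ A (k - 1) i l ⊓ a (q + 2) l j ⊓ A k j i ⊓ a (q + 2) j i,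
    y i ⊓ a (k - 1) i j ⊓ A (q + 3) j l ⊓ a k j l ⊓ A (q + 2) l i,
    y i ⊓ A k l i ⊓ a k i j ⊓ A k j l ⊓ a k j l,
    y i ⊓ A k l i ⊓ a k i j ⊓ A (k + 1) j l ⊓ a (k + 1) j l,
    y j ⊓ A k l j ⊓ a q j i ⊓ A k i l ⊓ a (q + 1) i l,
    y l ⊓ a k l i ⊓ A (q + 1) i j ⊓ a k i j ⊓ A (q + 1) j l,
    y i ⊓ A k j i ⊓ a (q + 1) i l ⊓ A k l j ⊓ a (q + 2) l j,
    y j ⊓ a k j l ⊓ A (q + 2) l i ⊓ a k l i ⊓ A (q + 2) i j,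
    y l ⊓ A k i l ⊓ a (q + 2) l j ⊓ A k j i ⊓ a (q + 3) j i,
    y i ⊓ a k i j ⊓ A (q + 3) j l ⊓ a k j l ⊓ A (q + 3) l i]

/-- The parameters `(σ, r, k, p)` of the admissible sequences of length `n` that start with `t`.
The permutation `σ` of the indices has `σ(1) = t`; in the first six types `k > 0`.  The bounds on
`k` and `p` follow from the length (types 7 and 8 do not depend on `p`). -/
def params (t : Fin 3) (n : ℕ) : Finset (Equiv.Perm (Fin 3) × Fin 14 × ℕ × ℕ) :=
  (Finset.univ ×ˢ Finset.univ ×ˢ Finset.range (n + 1) ×ˢ Finset.range (n + 1)).filter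
    fun s => s.1 0 = t ∧ (s.2.1 < 6 → 0 < s.2.2.1) ∧
      (adm (s.1 0) (s.1 1) (s.1 2) s.2.2.1 s.2.2.2 s.2.1).length = n

/-- The cumulative elements `x_t(n)`: the sum of all `f_α` with `α` of length `n` starting with
`t`. -/
def cumX (t : Fin 3) (n : ℕ) : D222 :=
  (params t n).sup fun s => f (s.1 0) (s.1 1) (s.1 2) s.2.2.1 s.2.2.2 s.2.1

/-- The cumulative elements `y_t(n)`: the sum of all `e_α` with `α` of length `n` starting with
`t`. -/
def cumY (t : Fin 3) (n : ℕ) : D222 :=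
  (params t n).sup fun s => e (s.1 0) (s.1 1) (s.1 2) s.2.2.1 s.2.2.2 s.2.1

/-- The elements `a_i(n)`; the two indices other than `i` are `i + 1` and `i + 2` modulo 3. -/
def genA : ℕ → Fin 3 → D222
  | 0, i => y (i + 1) ⊔ y (i + 2)
  | n + 1, i => cumX (i + 1) (n + 1) ⊔ cumX (i + 2) (n + 1) ⊔
      cumY (i + 1) (n + 2) ⊔ cumY (i + 2) (n + 2)

/-- The elements `b_i(n)`. -/
def genB : ℕ → Fin 3 → D222
  | 0, i => x i ⊔ y (i + 1) ⊔ y (i + 2)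
  | n + 1, i => genA (n + 1) i ⊔ cumX i (n + 2)

/-- The elements `c_i(n)`. -/
def genC : ℕ → Fin 3 → D222
  | 0, _ => y 0 ⊔ y 1 ⊔ y 2
  | n + 1, i => genA (n + 1) i ⊔ cumY i (n + 2)

/-- The sublattice generated by a set. -/
def gen (S : Set D222) : Sublattice D222 where
  carrier := latticeClosure S
  supClosed' := isSublattice_latticeClosure.supClosed
  infClosed' := isSublattice_latticeClosure.infClosed

/-- The sublattice `H^+(n)`: generated by the chains `a_i(0) ⊆ b_i(0)` for `n = 0` and by the chains
`a_i(n) ⊆ b_i(n) ⊆ c_i(n)` for `n ≥ 1`. -/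
def H : ℕ → Sublattice D222
  | 0 => gen (Set.range (genA 0) ∪ Set.range (genB 0))
  | n + 1 => gen (Set.range (genA (n + 1)) ∪ Set.range (genB (n + 1)) ∪ Set.range (genC (n + 1)))

/-- The element `I_n = a_1(n) + a_2(n) + a_3(n)`. -/
def unit (n : ℕ) : D222 := genA n 0 ⊔ genA n 1 ⊔ genA n 2

/-- The four-term chain `a_i(n) ⊆ b_i(n) ⊆ c_i(n) ⊆ I_n`. -/
def chain4 (n : ℕ) (i : Fin 3) : Fin 4 → D222 := ![genA n i, genB n i, genC n i, unit n]

/-- The three-term chain `a_i(0) ⊆ b_i(0) ⊆ c_i(0)`. -/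
def chain3 (i : Fin 3) : Fin 3 → D222 := ![genA 0 i, genB 0 i, genC 0 i]

end D222

/-! Reflection turns a representation of `D^{2,2,2}` by subspaces of `V` into one on a quotient of
`V ⊕ V ⊕ V`, and the three elementary maps from `V` to that quotient carry the values of `f_α` and
`e_α` to the values of `f_{cα}` and `e_{cα}` as long as the kernels are as small as possible, which
is guaranteed by the negativity of the defect. Since the images of the elementary maps span the
reflected representation, the values of `x_t(n + 1)` and `y_t(n + 1)` are zero, or everything, if
this holds for `x_t(n)` and `y_t(n)`. Starting from one-dimensional representations, the iterated
reflections therefore separate consecutive elements of the chains. On the other hand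
`a_i(n) = p_j + p_k` with `p_t = x_t(n) + y_t(n + 1)`, so `a_i(n) + a_j(n) a_k(n) = I_n`, and in a
modular lattice strict chains from such elements up to `I_n` generate their direct product. -/

section Modular

variable {L : Type*} [Lattice L] [IsModularLattice L] {a b u u' v v' : L}

theorem inf_sup_eq_of_le_sup (hau : a ≤ u) (hu : u ≤ a ⊔ b) (hbv : b ≤ v) : u ⊓ v ⊔ a = u := by
  rw [inf_sup_assoc_of_le v hau, inf_eq_left, sup_comm]
  exact hu.trans (sup_le_sup_left hbv a)

theorem inf_eq_inf_sup_inf_of_le_sup (hau : a ≤ u) (hu : u ≤ a ⊔ b) (hbv : b ≤ v) :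
    u ⊓ v = u ⊓ b ⊔ a ⊓ v := by
  conv_lhs => rw [← inf_sup_eq_of_le_sup hau hu le_rfl]
  exact sup_inf_assoc_of_le a (inf_le_right.trans hbv)

theorem sup_inf_eq_of_le_sup (hau : a ≤ u) (hu : u ≤ a ⊔ b) (hau' : a ≤ u') (hu' : u' ≤ a ⊔ b) :
    (u ⊔ u') ⊓ b = u ⊓ b ⊔ u' ⊓ b := by
  have hsup : u ⊔ u' = u ⊓ b ⊔ u' ⊓ b ⊔ a := by
    conv_lhs =>
      rw [← inf_sup_eq_of_le_sup hau hu le_rfl, ← inf_sup_eq_of_le_sup hau' hu' le_rfl,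
        ← sup_sup_distrib_right]
  rw [hsup, sup_inf_assoc_of_le a (sup_le inf_le_right inf_le_right), sup_eq_left]
  exact le_sup_of_le_left (inf_le_inf_right b hau)

theorem sup_inf_sup_eq_of_le_sup (hau : a ≤ u) (hu : u ≤ a ⊔ b) (hau' : a ≤ u')
    (hu' : u' ≤ a ⊔ b) (hbv : b ≤ v) (hv : v ≤ a ⊔ b) (hbv' : b ≤ v') (hv' : v' ≤ a ⊔ b) :
    (u ⊔ u') ⊓ (v ⊔ v') = u ⊓ v ⊔ u' ⊓ v' := by
  rw [sup_comm a b] at hv hv'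
  rw [inf_eq_inf_sup_inf_of_le_sup (le_sup_of_le_left hau) (sup_le hu hu')
      (le_sup_of_le_left hbv), sup_inf_eq_of_le_sup hau hu hau' hu', inf_comm a,
    sup_inf_eq_of_le_sup hbv hv hbv' hv', inf_eq_inf_sup_inf_of_le_sup hau hu hbv,
    inf_eq_inf_sup_inf_of_le_sup hau' hu' hbv', sup_sup_sup_comm, inf_comm v, inf_comm v']

end Modular

section Coindependent

variable {L ι : Type*} [Lattice L] [OrderTop L] [Fintype ι] [DecidableEq ι]

/-- The order dual of independence, relative to `T`: the join of each member of the family with the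
meet of all the others is `T`. -/
def Coindependent (a : ι → L) (T : L) : Prop := ∀ i, a i ⊔ (Finset.univ.erase i).inf a = T

theorem coindependent_sup_erase [OrderBot L] [Nontrivial ι] (p : ι → L) :
    Coindependent (fun i => (Finset.univ.erase i).sup p) (Finset.univ.sup p) := by
  intro i
  have hle (i : ι) : (Finset.univ.erase i).sup p ≤ Finset.univ.sup p :=
    Finset.sup_mono (Finset.erase_subset i _)
  refine le_antisymm (sup_le (hle i) ?_) (Finset.sup_le fun j _ => ?_)
  · obtain ⟨j, hji⟩ := exists_ne i
    exact (Finset.inf_le (Finset.mem_erase.2 ⟨hji, Finset.mem_univ j⟩)).trans (hle j)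
  · by_cases hji : j = i
    · subst hji
      refine le_sup_of_le_right (Finset.le_inf fun t ht => Finset.le_sup ?_)
      exact Finset.mem_erase.2 ⟨(Finset.ne_of_mem_erase ht).symm, Finset.mem_univ j⟩
    · exact le_sup_of_le_left (Finset.le_sup (Finset.mem_erase.2 ⟨hji, Finset.mem_univ j⟩))

namespace Coindependent

variable [IsModularLattice L] {a u u' : ι → L} {T : L}

theorem inf_sup_eq (h : Coindependent a T) (hau : a ≤ u) (huT : ∀ i, u i ≤ T) (i : ι) :
    Finset.univ.inf u ⊔ a i = u i := by
  rw [← Finset.insert_erase (Finset.mem_univ i), Finset.inf_insert]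
  exact inf_sup_eq_of_le_sup (hau i) ((huT i).trans (h i).ge) (Finset.inf_mono_fun fun j _ => hau j)

theorem inf_sup (h : Coindependent a T) (hau : a ≤ u) (huT : ∀ i, u i ≤ T) (hau' : a ≤ u')
    (huT' : ∀ i, u' i ≤ T) (s : Finset ι) : s.inf (u ⊔ u') = s.inf u ⊔ s.inf u' := by
  induction s using Finset.induction_on with
  | empty => simp
  | insert i s his ih =>
    have hT : T ≤ a i ⊔ s.inf a := (h i).ge.trans <| sup_le_sup_left
      (Finset.inf_mono fun j hj => Finset.mem_erase.2 ⟨ne_of_mem_of_not_mem hj his,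
        Finset.mem_univ j⟩) (a i)
    have hs {w : ι → L} (hw : ∀ j, w j ≤ T) : s.inf w ≤ a i ⊔ s.inf a := by
      rcases s.eq_empty_or_nonempty with rfl | ⟨j, hj⟩
      · simp
      · exact (Finset.inf_le hj).trans ((hw j).trans hT)
    rw [Finset.inf_insert, Finset.inf_insert, Finset.inf_insert, ih, Pi.sup_apply]
    exact sup_inf_sup_eq_of_le_sup (hau i) ((huT i).trans hT) (hau' i) ((huT' i).trans hT)
      (Finset.inf_mono_fun fun j _ => hau j) (hs huT) (Finset.inf_mono_fun fun j _ => hau' j)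
      (hs huT')

end Coindependent

/-- Chains with the common largest element `T` whose least elements are coindependent. -/
structure CoindependentChains {β : ι → Type*} [∀ i, LinearOrder (β i)] [∀ i, BoundedOrder (β i)]
    (c : ∀ i, β i → L) (T : L) : Prop where
  strictMono : ∀ i, StrictMono (c i)
  apply_top : ∀ i, c i ⊤ = T
  coindependent : Coindependent (fun i => c i ⊥) T

namespace CoindependentChains

variable {β : ι → Type*} [∀ i, LinearOrder (β i)] [∀ i, BoundedOrder (β i)] {c : ∀ i, β i → L}
  {T : L}

theorem apply_bot_le (h : CoindependentChains c T) (v : ∀ i, β i) :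
    (fun i => c i ⊥) ≤ fun i => c i (v i) :=
  fun i => (h.strictMono i).monotone bot_le

theorem apply_le (h : CoindependentChains c T) (i : ι) (b : β i) : c i b ≤ T :=
  h.apply_top i ▸ (h.strictMono i).monotone le_top

variable [IsModularLattice L]

theorem inf_le_inf_iff (h : CoindependentChains c T) (v w : ∀ i, β i) :
    (Finset.univ.inf fun i => c i (v i)) ≤ (Finset.univ.inf fun i => c i (w i)) ↔ v ≤ w := by
  refine ⟨fun hvw i => ?_,
    fun hvw => Finset.inf_mono_fun fun i _ => (h.strictMono i).monotone (hvw i)⟩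
  rw [← (h.strictMono i).le_iff_le,
    ← h.coindependent.inf_sup_eq (h.apply_bot_le v) (fun i => h.apply_le i _) i,
    ← h.coindependent.inf_sup_eq (h.apply_bot_le w) (fun i => h.apply_le i _) i]
  exact sup_le_sup_right hvw _

/-- The meets of one member from each chain. -/
def meets (h : CoindependentChains c T) : Sublattice L where
  carrier := Set.range fun v : ∀ i, β i => Finset.univ.inf fun i => c i (v i)
  supClosed' := by
    rintro _ ⟨v, rfl⟩ _ ⟨w, rfl⟩
    refine ⟨v ⊔ w, ?_⟩
    rw [← h.coindependent.inf_sup (h.apply_bot_le v) (fun i => h.apply_le i _)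
      (h.apply_bot_le w) fun i => h.apply_le i _]
    exact Finset.inf_congr rfl fun i _ => (h.strictMono i).monotone.map_sup _ _
  infClosed' := by
    rintro _ ⟨v, rfl⟩ _ ⟨w, rfl⟩
    refine ⟨v ⊓ w, ?_⟩
    rw [← Finset.inf_inf]
    exact Finset.inf_congr rfl fun i _ => (h.strictMono i).monotone.map_inf _ _

theorem apply_mem_meets (h : CoindependentChains c T) (i : ι) (b : β i) : c i b ∈ h.meets := by
  refine ⟨Function.update ⊤ i b, le_antisymm ?_ (Finset.le_inf fun j _ => ?_)⟩
  · simpa using Finset.inf_le (f := fun j => c j (Function.update ⊤ i b j)) (Finset.mem_univ i)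
  · obtain rfl | hji := eq_or_ne j i
    · simp
    · simpa [hji, h.apply_top] using h.apply_le i b

theorem exists_orderIso [Nonempty ι] (h : CoindependentChains c T) {S : Sublattice L}
    (hS : IsLeast {S : Sublattice L | ∀ i b, c i b ∈ S} S) :
    ∃ φ : (∀ i, β i) ≃o S, ∀ v, (φ v : L) = Finset.univ.inf fun i => c i (v i) := by
  have mem_S (v : ∀ i, β i) : (Finset.univ.inf fun i => c i (v i)) ∈ S := by
    rw [← Finset.inf'_eq_inf Finset.univ_nonempty]
    exact S.infClosed.finsetInf'_mem _ fun i _ => hS.1 i (v i)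
  let φ : (∀ i, β i) ↪o S :=
    OrderEmbedding.ofMapLEIff (fun v => ⟨_, mem_S v⟩) h.inf_le_inf_iff
  refine ⟨RelIso.ofSurjective φ ?_, fun v => rfl⟩
  rintro ⟨z, hz⟩
  obtain ⟨v, rfl⟩ := hS.2 h.apply_mem_meets hz
  exact ⟨v, rfl⟩

end CoindependentChains

end Coindependent

namespace D222

section Lift

variable {M : Type*} [Lattice M] [OrderTop M] (X Y : Fin 3 → M)

/-- The value of a lattice polynomial at given values of its variables. -/
def Poly.eval : Poly → M
  | .x i => X i
  | .y i => Y i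
  | .one => ⊤
  | .sum s t => s.eval ⊔ t.eval
  | .inter s t => s.eval ⊓ t.eval

variable {X Y} [IsModularLattice M]

theorem Poly.Le.eval_le_eval (hXY : X ≤ Y) {s t : Poly} (h : Poly.Le s t) :
    s.eval X Y ≤ t.eval X Y := by
  induction h with
  | refl s => exact le_rfl
  | trans _ _ h₁ h₂ => exact h₁.trans h₂
  | left_sum s t => exact le_sup_left
  | right_sum s t => exact le_sup_right
  | sum_le _ _ h₁ h₂ => exact sup_le h₁ h₂
  | inter_left s t => exact inf_le_left
  | inter_right s t => exact inf_le_right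
  | le_inter _ _ h₁ h₂ => exact le_inf h₁ h₂
  | le_one s => exact le_top
  | modular t _ h => exact sup_inf_le_assoc_of_le _ h
  | x_le_y i => exact hXY i

/-- The universal property of `D^{2,2,2}`: elements `X i ≤ Y i` of a modular lattice with unity are
the values of the generators under a lattice homomorphism. -/
def lift (hXY : X ≤ Y) : LatticeHom D222 M where
  toFun := Quotient.lift (Poly.eval X Y) fun _ _ h =>
    le_antisymm (h.1.eval_le_eval hXY) (h.2.eval_le_eval hXY)
  map_sup' := by rintro ⟨s⟩ ⟨t⟩; rfl
  map_inf' := by rintro ⟨s⟩ ⟨t⟩; rfl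

end Lift

/-- The indices `i`, `j`, `l` are distinct. -/
def Tri (i j l : Fin 3) : Prop := i ≠ j ∧ j ≠ l ∧ i ≠ l

theorem Tri.third {i j l : Fin 3} (h : Tri i j l) : third i j = l := by
  revert i j l; unfold Tri D222.third; decide

theorem Tri.rot {i j l : Fin 3} (h : Tri i j l) : Tri j l i := ⟨h.2.1, h.2.2.symm, h.1.symm⟩

theorem Tri.swap {i j l : Fin 3} (h : Tri i j l) : Tri j i l := ⟨h.1.symm, h.2.2, h.2.1⟩

theorem tri_perm (σ : Equiv.Perm (Fin 3)) : Tri (σ 0) (σ 1) (σ 2) :=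
  ⟨σ.injective.ne (by decide), σ.injective.ne (by decide), σ.injective.ne (by decide)⟩

/-! ### Atomic elements -/

theorem a_zero (i j : Fin 3) : a 0 i j = ⊤ := rfl

theorem A_zero (i j : Fin 3) : A 0 i j = ⊤ := rfl

theorem a_succ {i j l : Fin 3} (h : Tri i j l) (n : ℕ) : a (n + 1) i j = x i ⊔ y j ⊓ a n j l := by
  rw [a, h.third]

theorem A_succ {i j l : Fin 3} (h : Tri i j l) (n : ℕ) : A (n + 1) i j = y i ⊔ x j ⊓ A n l i := by
  rw [A, h.third]

theorem a_succ_le (n : ℕ) (i j : Fin 3) : a (n + 1) i j ≤ a n i j := by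
  induction n generalizing i j with
  | zero => exact le_top
  | succ n ih => exact sup_le_sup_left (inf_le_inf_left _ (ih _ _)) _

theorem A_succ_le (n : ℕ) (i j : Fin 3) : A (n + 1) i j ≤ A n i j := by
  induction n generalizing i j with
  | zero => exact le_top
  | succ n ih => exact sup_le_sup_left (inf_le_inf_left _ (ih _ _)) _

theorem x_le_a (n : ℕ) (i j : Fin 3) : x i ≤ a n i j := by
  cases n with
  | zero => exact le_top
  | succ n => exact le_sup_left

theorem y_le_A (n : ℕ) (i j : Fin 3) : y i ≤ A n i j := by
  cases n with
  | zero => exact le_top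
  | succ n => exact le_sup_left

theorem x_le_A (n : ℕ) (i j : Fin 3) : x i ≤ A n i j := (x_le_y i).trans (y_le_A n i j)

theorem x_right_le_a (n : ℕ) (i j : Fin 3) : x j ≤ a n i j := by
  cases n with
  | zero => exact le_top
  | succ n => exact le_sup_of_le_right (le_inf (x_le_y j) (x_le_a _ _ _))

theorem y_inf_a_le_a {i j l : Fin 3} (h : Tri i j l) (q : ℕ) :
    y i ⊓ a q i l ≤ a q j i := by
  cases q with
  | zero => exact le_top
  | succ q =>
    rw [a_succ h.swap]
    exact le_sup_of_le_right (inf_le_inf_left _ (a_succ_le q i l))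

theorem x_inf_A_le_A {i j l : Fin 3} (h : Tri i j l) (q : ℕ) : x l ⊓ A q i j ≤ A q j l := by
  cases q with
  | zero => exact le_top
  | succ q =>
    rw [A_succ h.rot]
    exact le_sup_of_le_right (inf_le_inf_left _ (A_succ_le q i j))

theorem y_inf_sup_inf_A_le_A {i j l : Fin 3} (h : Tri i j l) (q : ℕ) :
    y l ⊓ (x i ⊔ x j) ⊓ A q j l ≤ A (q + 1) i j := by
  have hx : (x i ⊔ x j) ⊓ A q j l = x i ⊓ A q j l ⊔ x j := by
    rw [sup_comm, sup_inf_assoc_of_le _ (x_le_A q j l), sup_comm]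
  calc y l ⊓ (x i ⊔ x j) ⊓ A q j l
      = y l ⊓ (x i ⊓ A q j l ⊔ x j) := by rw [inf_assoc, hx]
    _ ≤ (x i ⊓ A q j l ⊔ x j) ⊓ A q l i :=
          le_inf inf_le_right (inf_le_left.trans (y_le_A q l i))
    _ = x i ⊓ A q j l ⊔ x j ⊓ A q l i := sup_inf_assoc_of_le _ (x_inf_A_le_A h.rot q)
    _ ≤ y i ⊔ x j ⊓ A q l i := sup_le_sup_right (inf_le_left.trans (x_le_y i)) _
    _ = A (q + 1) i j := (A_succ h q).symm

/-! ### The shapes of the admissible elements -/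

/-- The elements `e_α` for `α` of even length. -/
def eEven (i j l : Fin 3) (α β γ δ : ℕ) : D222 := y j ⊓ A α l j ⊓ a β j i ⊓ A γ i l ⊓ a δ i l

/-- The elements `e_α` for `α` of odd length. -/
def eOdd (i j l : Fin 3) (α β γ δ : ℕ) : D222 := y l ⊓ a α l i ⊓ A β i j ⊓ a γ i j ⊓ A δ j l

/-- The elements `f_α` for `α` of even length. -/
def fEven (i j l : Fin 3) (q k : ℕ) : D222 := y i ⊓ y j ⊓ a q i l ⊓ A k l j

/-- The elements `f_α` for `α` of odd length and of type 2, 4, 6 or 8. -/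
def fSum (i j l : Fin 3) (q k : ℕ) : D222 := y l ⊓ (x i ⊔ x j) ⊓ A q j l ⊓ a k l i

/-- The elements `f_α` for `α` of odd length and of type 7, 10, 12 or 14. -/
def fSingle (i j l : Fin 3) (q k : ℕ) : D222 := x l ⊓ A q i j ⊓ a k i j

theorem fEven_le_eEven {i j l : Fin 3} (h : Tri i j l) (q k : ℕ) :
    fEven i j l q k ≤ eEven i j l k q (k + 1) q := by
  have h₁ := y_inf_a_le_a h q
  have h₂ := y_le_A (k + 1) i l
  unfold fEven eEven
  order

theorem fEven_rot_le_eEven {i j l : Fin 3} (h : Tri i j l) (q k : ℕ) :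
    fEven j l i q k ≤ eEven i j l k q k (q + 1) := by
  have h₁ := y_inf_a_le_a h.rot q
  have h₂ := y_le_A k l j
  have h₃ : y l ⊓ a q l j ≤ a (q + 1) i l := by
    rw [a_succ (l := j) ⟨h.2.2, h.2.1.symm, h.1⟩]
    exact le_sup_right
  unfold fEven eEven
  order

theorem fSum_le_eOdd {i j l : Fin 3} (h : Tri i j l) (q k : ℕ) :
    fSum i j l q k ≤ eOdd i j l k (q + 1) (k + 1) q := by
  have h₁ := y_inf_sup_inf_A_le_A h q
  have h₂ := x_le_a (k + 1) i j
  have h₃ := x_right_le_a (k + 1) i j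
  unfold fSum eOdd
  order

theorem fSingle_le_eOdd {i j l : Fin 3} (h : Tri i j l) (q k : ℕ) :
    fSingle i j l q k ≤ eOdd i j l k q k q := by
  have h₁ := x_inf_A_le_A h q
  have h₂ := x_le_y l
  have h₃ := x_le_a k l i
  unfold fSingle eOdd
  order

theorem f_eq (i j l : Fin 3) (k p : ℕ) : f i j l k p =
    ![fEven i j l (k + 3 * p) (k - 1),
      fSum i j l (k + 3 * p) (k - 1),
      fEven l i j (k + 3 * p + 1) (k - 1),
      fSum l i j (k + 3 * p + 1) (k - 1),
      fEven j l i (k + 3 * p + 2) (k - 1),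
      fSum j l i (k + 3 * p + 2) (k - 1),
      fSingle j l i k k,
      fSum j l i k k,
      fEven j l i (k + 3 * p) k,
      fSingle i j l (k + 3 * p + 1) k,
      fEven i j l (k + 3 * p + 1) k,
      fSingle l i j (k + 3 * p + 2) k,
      fEven l i j (k + 3 * p + 2) k,
      fSingle j l i (k + 3 * p + 3) k] := rfl

theorem e_eq (i j l : Fin 3) (k p : ℕ) : e i j l k p =
    ![eEven i j l (k - 1) (k + 3 * p) k (k + 3 * p),
      eOdd i j l (k - 1) (k + 3 * p + 1) k (k + 3 * p),
      eEven l i j (k - 1) (k + 3 * p + 1) k (k + 3 * p + 1),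
      eOdd l i j (k - 1) (k + 3 * p + 2) k (k + 3 * p + 1),
      eEven j l i (k - 1) (k + 3 * p + 2) k (k + 3 * p + 2),
      eOdd j l i (k - 1) (k + 3 * p + 3) k (k + 3 * p + 2),
      eOdd j l i k k k k,
      eOdd j l i k (k + 1) (k + 1) k,
      eEven i j l k (k + 3 * p) k (k + 3 * p + 1),
      eOdd i j l k (k + 3 * p + 1) k (k + 3 * p + 1),
      eEven l i j k (k + 3 * p + 1) k (k + 3 * p + 2),
      eOdd l i j k (k + 3 * p + 2) k (k + 3 * p + 2),
      eEven j l i k (k + 3 * p + 2) k (k + 3 * p + 3),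
      eOdd j l i k (k + 3 * p + 3) k (k + 3 * p + 3)] := by
  have h₆ : y i ⊓ A k l i ⊓ a k i j ⊓ A k j l ⊓ a k j l = eOdd j l i k k k k := by
    unfold eOdd; ac_rfl
  have h₇ : y i ⊓ A k l i ⊓ a k i j ⊓ A (k + 1) j l ⊓ a (k + 1) j l =
      eOdd j l i k (k + 1) (k + 1) k := by
    unfold eOdd; ac_rfl
  rw [← h₆, ← h₇]
  rfl

theorem f_le_e {i j l : Fin 3} (h : Tri i j l) {k : ℕ} (p : ℕ) {r : Fin 14} (hk : r < 6 → 0 < k) :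
    f i j l k p r ≤ e i j l k p r := by
  rw [f_eq, e_eq]
  by_cases hr : r < 6
  · obtain ⟨k, rfl⟩ := Nat.exists_eq_succ_of_ne_zero (hk hr).ne'
    fin_cases r <;> first | exact absurd hr (by decide) | skip
    exacts [fEven_le_eEven h _ _, fSum_le_eOdd h _ _, fEven_le_eEven h.rot.rot _ _,
      fSum_le_eOdd h.rot.rot _ _, fEven_le_eEven h.rot _ _, fSum_le_eOdd h.rot _ _]
  · fin_cases r <;> first | exact absurd (by decide) hr | skip
    exacts [fSingle_le_eOdd h.rot _ _, fSum_le_eOdd h.rot _ _, fEven_rot_le_eEven h _ _,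
      fSingle_le_eOdd h _ _, fEven_rot_le_eEven h.rot.rot _ _, fSingle_le_eOdd h.rot.rot _ _,
      fEven_rot_le_eEven h.rot _ _, fSingle_le_eOdd h.rot _ _]

/-! ### Cumulative elements -/

/-- The length of the admissible sequences. -/
def len (k p : ℕ) : Fin 14 → ℕ :=
  ![6 * p + 4 * k, 6 * p + 4 * k + 1, 6 * p + 4 * k + 2, 6 * p + 4 * k + 3, 6 * p + 4 * k + 4,
    6 * p + 4 * k + 5, 4 * k + 1, 4 * k + 3, 6 * p + 4 * k + 2, 6 * p + 4 * k + 3,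
    6 * p + 4 * k + 4, 6 * p + 4 * k + 5, 6 * p + 4 * k + 6, 6 * p + 4 * k + 7]

theorem length_adm (i j l : Fin 3) (k p : ℕ) (r : Fin 14) :
    (adm i j l k p r).length = len k p r := by
  fin_cases r <;> simp [adm, len, gam, bet, rep] <;> ring

theorem mem_params {t : Fin 3} {n : ℕ} {σ : Equiv.Perm (Fin 3)} {r : Fin 14} {k p : ℕ} :
    (σ, r, k, p) ∈ params t n ↔ (k ≤ n ∧ p ≤ n) ∧ σ 0 = t ∧ (r < 6 → 0 < k) ∧ len k p r = n := by
  simp only [params, Finset.mem_filter, Finset.mem_product, Finset.mem_univ, Finset.mem_range,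
    true_and, length_adm, Nat.lt_succ_iff]

theorem cumX_le_cumY (t : Fin 3) (n : ℕ) : cumX t n ≤ cumY t n :=
  Finset.sup_mono_fun fun ⟨σ, _, _, p⟩ hs => f_le_e (tri_perm σ) p (mem_params.1 hs).2.2.1

theorem len_pos {r : Fin 14} {k : ℕ} (p : ℕ) (hk : r < 6 → 0 < k) : 0 < len k p r := by
  fin_cases r <;> simp [len, Fin.lt_def] at hk ⊢
  omega

theorem eq_of_len_eq_one {r : Fin 14} {k p : ℕ} (hk : r < 6 → 0 < k) (h : len k p r = 1) :
    r = 6 ∧ k = 0 := by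
  fin_cases r <;> simp [len, Fin.lt_def] at hk h ⊢ <;> omega

theorem eq_of_len_eq_two {r : Fin 14} {k p : ℕ} (hk : r < 6 → 0 < k) (h : len k p r = 2) :
    r = 8 ∧ k = 0 ∧ p = 0 := by
  fin_cases r <;> simp [len, Fin.lt_def] at hk h ⊢ <;> omega

theorem cumX_zero (t : Fin 3) : cumX t 0 = ⊥ := by
  have hempty : params t 0 = ∅ := Finset.eq_empty_of_forall_notMem fun ⟨_, _, _, p⟩ hs =>
    (len_pos p (mem_params.1 hs).2.2.1).ne' (mem_params.1 hs).2.2.2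
  rw [cumX, hempty, Finset.sup_empty]

theorem swap_mem_params_one (t : Fin 3) : (Equiv.swap 0 t, 6, 0, 0) ∈ params t 1 :=
  mem_params.2 ⟨by decide, Equiv.swap_apply_left 0 t, by decide, rfl⟩

theorem cumX_one (t : Fin 3) : cumX t 1 = x t := by
  refine le_antisymm (Finset.sup_le ?_) (le_trans ?_ (Finset.le_sup (swap_mem_params_one t)))
  · rintro ⟨σ, r, k, p⟩ hs
    obtain ⟨-, rfl, hk, hlen⟩ := mem_params.1 hs
    obtain ⟨rfl, rfl⟩ := eq_of_len_eq_one hk hlen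
    exact inf_le_left.trans inf_le_left
  · simp [f, a_zero, A_zero]

theorem cumY_one (t : Fin 3) : cumY t 1 = y t := by
  refine le_antisymm (Finset.sup_le ?_) (le_trans ?_ (Finset.le_sup (swap_mem_params_one t)))
  · rintro ⟨σ, r, k, p⟩ hs
    obtain ⟨-, rfl, hk, hlen⟩ := mem_params.1 hs
    obtain ⟨rfl, rfl⟩ := eq_of_len_eq_one hk hlen
    exact inf_le_left.trans (inf_le_left.trans (inf_le_left.trans inf_le_left))
  · simp [e, a_zero, A_zero]

/-! ### Representations and their reflections -/

universe u v

/-- A representation of `D^{2,2,2}` by subspaces `x i ≤ y i` of a vector space. -/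
structure Model (K : Type u) [DivisionRing K] where
  V : Type v
  [addCommGroup : AddCommGroup V]
  [module : Module K V]
  x : Fin 3 → Submodule K V
  y : Fin 3 → Submodule K V
  x_le_y : x ≤ y

theorem finrank_eq_finrank_map_add {K V W : Type*} [DivisionRing K] [AddCommGroup V]
    [Module K V] [AddCommGroup W] [Module K W] [Module.Finite K V] (φ : V →ₗ[K] W)
    (U : Submodule K V) :
    Module.finrank K U =
      Module.finrank K (U.map φ) + Module.finrank K ↥(LinearMap.ker φ ⊓ U) := by
  rw [← LinearMap.finrank_range_add_finrank_ker (φ.domRestrict U), LinearMap.range_domRestrict,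
    LinearMap.ker_domRestrict,
    ← (Submodule.comapSubtypeEquivOfLe (inf_le_right : LinearMap.ker φ ⊓ U ≤ U)).finrank_eq,
    Submodule.comap_inf, Submodule.comap_subtype_self, inf_top_eq]

theorem finrank_add_le_of_map_le {K V W : Type*} [DivisionRing K] [AddCommGroup V] [Module K V]
    [AddCommGroup W] [Module K W] [Module.Finite K V] [Module.Finite K W] (φ : V →ₗ[K] W)
    {U : Submodule K V} {B C : Submodule K W} (hU : U.map φ ≤ C) (hB : B ≤ C) :
    Module.finrank K U + Module.finrank K B ≤
      Module.finrank K ↥(B.comap φ ⊓ U) + Module.finrank K C := by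
  have hmap : (B.comap φ ⊓ U).map φ = U.map φ ⊓ B :=
    (congrArg _ (inf_comm _ _)).trans Submodule.map_inf_eq_map_inf_comap.symm
  have hker : LinearMap.ker φ ⊓ (B.comap φ ⊓ U) = LinearMap.ker φ ⊓ U := by
    rw [← inf_assoc, inf_eq_left.2 (LinearMap.ker_le_comap φ)]
  have hrank := finrank_eq_finrank_map_add φ U
  have hrank' := finrank_eq_finrank_map_add φ (B.comap φ ⊓ U)
  have hmod := Submodule.finrank_sup_add_finrank_inf_eq (U.map φ) B
  have hle := Submodule.finrank_mono (sup_le hU hB)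
  rw [hmap, hker] at hrank'
  omega

namespace Model

attribute [instance] Model.addCommGroup Model.module

variable {K : Type u} [DivisionRing K] (R : Model.{u, v} K)

/-- The value of an element of `D^{2,2,2}` in a representation. -/
def ev : LatticeHom D222 (Submodule K R.V) := D222.lift R.x_le_y

@[simp] theorem ev_x (i : Fin 3) : R.ev (D222.x i) = R.x i := rfl

@[simp] theorem ev_y (i : Fin 3) : R.ev (D222.y i) = R.y i := rfl

@[simp] theorem ev_top : R.ev ⊤ = ⊤ := rfl

/-- The triples `w` whose image in the reflected representation is zero. -/
def relations : Submodule K (Fin 3 → R.V) :=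
  Submodule.pi Set.univ R.x ⊔ LinearMap.range (LinearMap.pi fun _ : Fin 3 => LinearMap.id (R := K))

theorem mem_relations {w : Fin 3 → R.V} : w ∈ R.relations ↔ ∃ u, ∀ i, w i - u ∈ R.x i := by
  rw [relations, Submodule.mem_sup]
  constructor
  · rintro ⟨d, hd, _, ⟨u, rfl⟩, rfl⟩
    exact ⟨u, fun i => by simpa using hd i trivial⟩
  · rintro ⟨u, hu⟩
    exact ⟨fun i => w i - u, fun i _ => hu i, _, ⟨u, rfl⟩, by ext i; simp⟩

/-- The reflected representation `Φ⁺ R`: its space is the quotient of `V ⊕ V ⊕ V` by the diagonal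
and by the subspace `x 0 ⊕ x 1 ⊕ x 2`, and the `i`-th summand `V` and its subspace `y i` become the
subspaces `y i` and `x i`. -/
def reflect : Model.{u, v} K where
  V := (Fin 3 → R.V) ⧸ R.relations
  x i := (R.y i).map (R.relations.mkQ ∘ₗ LinearMap.single K (fun _ => R.V) i)
  y i := LinearMap.range (R.relations.mkQ ∘ₗ LinearMap.single K (fun _ => R.V) i)
  x_le_y _ := LinearMap.map_le_range

/-- The elementary maps `φ_i` from a representation to its reflection. -/
def φ (i : Fin 3) : R.V →ₗ[K] R.reflect.V :=
  R.relations.mkQ ∘ₗ LinearMap.single K (fun _ => R.V) i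

theorem reflect_x (i : Fin 3) : R.reflect.x i = (R.y i).map (R.φ i) := rfl

theorem sum_φ_apply (w : Fin 3 → R.V) : ∑ i, R.φ i (w i) = R.relations.mkQ w := by
  refine (map_sum R.relations.mkQ _ _).symm.trans (congrArg R.relations.mkQ ?_)
  exact LinearMap.sum_single_apply _ w

theorem sum_φ_eq_zero_iff {w : Fin 3 → R.V} :
    ∑ i, R.φ i (w i) = 0 ↔ ∃ u, ∀ i, w i - u ∈ R.x i := by
  rw [sum_φ_apply]
  exact (Submodule.Quotient.mk_eq_zero _).trans R.mem_relations

theorem sum_φ (v : R.V) : ∑ i, R.φ i v = 0 :=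
  (R.sum_φ_eq_zero_iff (w := fun _ => v)).2 ⟨v, fun i => by simp⟩

theorem iSup_range_φ : ⨆ i, LinearMap.range (R.φ i) = ⊤ := by
  rw [eq_top_iff]
  rintro v -
  obtain ⟨w, rfl⟩ := R.relations.mkQ_surjective v
  exact R.sum_φ_apply w ▸ sum_mem fun i _ => Submodule.mem_iSup_of_mem i ⟨w i, rfl⟩

theorem φ_apply_eq_zero_iff_exists (i : Fin 3) {v : R.V} :
    R.φ i v = 0 ↔ ∃ u, v - u ∈ R.x i ∧ ∀ j ≠ i, u ∈ R.x j := by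
  have hsum : R.φ i v = ∑ j, R.φ j (Pi.single (M := fun _ => R.V) i v j) := by
    rw [Finset.sum_eq_single i (fun j _ hj => by rw [Pi.single_eq_of_ne hj, map_zero])
      fun h => absurd (Finset.mem_univ i) h, Pi.single_eq_same]
  rw [hsum, sum_φ_eq_zero_iff]
  refine exists_congr fun u => ⟨fun h => ⟨?_, fun j hj => ?_⟩, fun h j => ?_⟩
  · simpa using h i
  · simpa [Pi.single_eq_of_ne hj] using h j
  · rcases eq_or_ne j i with rfl | hj
    · simpa using h.1
    · simpa [Pi.single_eq_of_ne hj] using h.2 j hj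

variable {R}

theorem φ_apply_eq_zero {i : Fin 3} {v : R.V} (hv : v ∈ R.x i) : R.φ i v = 0 :=
  (R.φ_apply_eq_zero_iff_exists i).2 ⟨0, by simpa using hv, fun j _ => zero_mem _⟩

theorem exists_forall_φ_eq {w : Fin 3 → R.V} (hw : ∑ i, R.φ i (w i) = 0) :
    ∃ u, ∀ i, R.φ i u = R.φ i (w i) := by
  obtain ⟨u, hu⟩ := R.sum_φ_eq_zero_iff.1 hw
  exact ⟨u, fun i => (sub_eq_zero.1 (map_sub (R.φ i) _ _ ▸ φ_apply_eq_zero (hu i))).symm⟩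

open scoped Function

section Disjoint

variable (hR : Pairwise (Disjoint on R.x))
include hR

theorem ev_bot : R.ev ⊥ = ⊥ := by
  have h01 : R.x 0 ⊓ R.x 1 = ⊥ := (hR (by decide)).eq_bot
  change R.ev (D222.x 0 ⊓ D222.x 1 ⊓ D222.x 2) = ⊥
  rw [map_inf, map_inf, ev_x, ev_x, h01, bot_inf_eq]

theorem φ_apply_eq_zero_iff {i : Fin 3} {v : R.V} : R.φ i v = 0 ↔ v ∈ R.x i := by
  refine ⟨fun h => ?_, φ_apply_eq_zero⟩
  obtain ⟨u, hu, hux⟩ := (R.φ_apply_eq_zero_iff_exists i).1 h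
  obtain ⟨j, l, hj, hl, hjl⟩ : ∃ j l : Fin 3, j ≠ i ∧ l ≠ i ∧ j ≠ l := by
    clear hu hux h; revert i; decide
  have hu0 : u = 0 := Submodule.disjoint_def.1 (hR hjl) u (hux j hj) (hux l hl)
  simpa [hu0] using hu

theorem φ_apply_mem_reflect_x_iff {i : Fin 3} {v : R.V} :
    R.φ i v ∈ R.reflect.x i ↔ v ∈ R.y i := by
  refine ⟨?_, fun h => ⟨v, h, rfl⟩⟩
  rintro ⟨u, hu, huv⟩
  have hx : u - v ∈ R.x i := by
    rw [← φ_apply_eq_zero_iff hR, map_sub]; exact sub_eq_zero.2 huv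
  simpa using sub_mem hu (R.x_le_y i hx)

end Disjoint

/-! ### Negative representations -/

variable (R) in
/-- Every nonzero subrepresentation has negative defect. This makes the elementary maps have the
least possible kernels, and it is inherited by the reflected representation. -/
structure IsNegative : Prop where
  finite : Module.Finite K R.V
  nontrivial : Nontrivial R.V
  defect : ∀ U : Submodule K R.V, U ≠ ⊥ →
    ∑ i, (Module.finrank K ↥(R.x i ⊓ U) + Module.finrank K ↥(R.y i ⊓ U)) < 3 * Module.finrank K U

theorem IsNegative.disjoint_x (h : R.IsNegative) : Pairwise (Disjoint on R.x) := by
  intro i j hij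
  refine disjoint_iff.2 (by_contra fun hne => (h.defect _ hne).not_ge ?_)
  set U := R.x i ⊓ R.x j
  have hU : ∀ t ∈ ({i, j} : Finset (Fin 3)), U ≤ R.x t := by
    simp only [Finset.mem_insert, Finset.mem_singleton]
    rintro t (rfl | rfl)
    exacts [inf_le_left, inf_le_right]
  calc 3 * Module.finrank K U
      ≤ ∑ t ∈ {i, j}, (Module.finrank K U + Module.finrank K U) := by
        rw [Finset.sum_pair hij]; omega
    _ = ∑ t ∈ {i, j}, (Module.finrank K ↥(R.x t ⊓ U) + Module.finrank K ↥(R.y t ⊓ U)) :=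
        Finset.sum_congr rfl fun t ht => by
          rw [inf_eq_right.2 (hU t ht), inf_eq_right.2 ((hU t ht).trans (R.x_le_y t))]
    _ ≤ _ := Finset.sum_le_sum_of_subset (Finset.subset_univ _)

theorem exists_φ_preimages_of_sum_eq_zero {v : Fin 3 → R.reflect.V}
    (hv : ∀ i, v i ∈ R.reflect.y i) (hsum : ∑ i, v i = 0) : ∃ u, ∀ i, R.φ i u = v i := by
  choose w hw using hv
  obtain ⟨u, hu⟩ := exists_forall_φ_eq (w := w) ((Finset.sum_congr rfl fun i _ => hw i).trans hsum)
  exact ⟨u, fun i => (hu i).trans (hw i)⟩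

theorem sum_finrank_reflect_y_inf_le [Module.Finite K R.V] [Module.Finite K R.reflect.V]
    (U : Submodule K R.reflect.V) :
    ∑ i, Module.finrank K ↥(R.reflect.y i ⊓ U) ≤
      Module.finrank K ↥(⨅ i, U.comap (R.φ i)) + Module.finrank K U := by
  set T := ⨅ i, U.comap (R.φ i)
  have hT : ∀ i, ∀ w ∈ T, R.φ i w ∈ R.reflect.y i ⊓ U := fun i w hw =>
    ⟨⟨w, rfl⟩, (Submodule.mem_iInf _).1 hw i⟩
  let sum : (∀ i : Fin 3, ↥(R.reflect.y i ⊓ U)) →ₗ[K] R.reflect.V :=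
    LinearMap.lsum K (fun i => ↥(R.reflect.y i ⊓ U)) ℕ fun i => (R.reflect.y i ⊓ U).subtype
  have sum_apply : ∀ v, sum v = ∑ i, (v i : R.reflect.V) := fun v => by simp [sum]
  let diag : T →ₗ[K] (∀ i : Fin 3, ↥(R.reflect.y i ⊓ U)) :=
    LinearMap.pi fun i => (R.φ i).restrict (hT i)
  have hrange : LinearMap.range sum ≤ U := by
    rintro _ ⟨v, rfl⟩
    exact sum_apply v ▸ sum_mem fun i _ => (v i).2.2
  have hker : LinearMap.ker sum ≤ LinearMap.range diag := by
    intro v hv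
    obtain ⟨u, hu⟩ := exists_φ_preimages_of_sum_eq_zero (fun i => (v i).2.1)
      ((sum_apply v).symm.trans hv)
    have huT : u ∈ T := (Submodule.mem_iInf _).2 fun i => by
      rw [Submodule.mem_comap, hu]; exact (v i).2.2
    exact ⟨⟨u, huT⟩, funext fun i => Subtype.ext (hu i)⟩
  calc ∑ i, Module.finrank K ↥(R.reflect.y i ⊓ U)
      = Module.finrank K (LinearMap.ker sum) + Module.finrank K (LinearMap.range sum) := by
        rw [← Module.finrank_pi_fintype, add_comm, LinearMap.finrank_range_add_finrank_ker]
    _ ≤ Module.finrank K (LinearMap.range diag) + Module.finrank K U :=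
        add_le_add (Submodule.finrank_mono hker) (Submodule.finrank_mono hrange)
    _ ≤ Module.finrank K T + Module.finrank K U :=
        Nat.add_le_add_right (LinearMap.finrank_range_le diag) _

namespace IsNegative

variable (hR : R.IsNegative)
include hR

theorem finite_reflect : Module.Finite K R.reflect.V :=
  have := hR.finite
  inferInstanceAs (Module.Finite K ((Fin 3 → R.V) ⧸ R.relations))

theorem nontrivial_reflect : Nontrivial R.reflect.V := by
  by_contra hn
  rw [not_nontrivial_iff_subsingleton] at hn
  have hx : ∀ i, R.x i = ⊤ := fun i => eq_top_iff.2 fun w _ =>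
    (φ_apply_eq_zero_iff hR.disjoint_x).1 (Subsingleton.elim _ _)
  have h01 : Disjoint (R.x 0) (R.x 1) := hR.disjoint_x (by decide)
  rw [hx, hx, disjoint_self] at h01
  have := hR.nontrivial
  exact top_ne_bot h01

theorem finrank_le_of_map_φ_le {i : Fin 3} {T : Submodule K R.V} {U : Submodule K R.reflect.V}
    (hT : T.map (R.φ i) ≤ R.reflect.y i ⊓ U) :
    Module.finrank K T ≤
      Module.finrank K ↥(R.x i ⊓ T) + Module.finrank K ↥(R.reflect.y i ⊓ U) := by
  have := hR.finite
  have := hR.finite_reflect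
  have hker : (⊥ : Submodule K R.reflect.V).comap (R.φ i) = R.x i := by
    ext w; exact φ_apply_eq_zero_iff hR.disjoint_x
  have h := finrank_add_le_of_map_le (R.φ i) hT bot_le
  rwa [hker, finrank_bot, add_zero] at h

theorem finrank_add_finrank_reflect_x_inf_le {i : Fin 3} {T : Submodule K R.V}
    {U : Submodule K R.reflect.V} (hT : T.map (R.φ i) ≤ R.reflect.y i ⊓ U) :
    Module.finrank K T + Module.finrank K ↥(R.reflect.x i ⊓ U) ≤
      Module.finrank K ↥(R.y i ⊓ T) + Module.finrank K ↥(R.reflect.y i ⊓ U) := by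
  have := hR.finite
  have := hR.finite_reflect
  have hcomap : (R.reflect.x i ⊓ U).comap (R.φ i) ⊓ T = R.y i ⊓ T := by
    ext w
    have hU : w ∈ T → R.φ i w ∈ U := fun hw => (hT ⟨w, hw, rfl⟩).2
    have hy := φ_apply_mem_reflect_x_iff hR.disjoint_x (i := i) (v := w)
    simp only [Submodule.mem_inf, Submodule.mem_comap]
    tauto
  rw [← hcomap]
  exact finrank_add_le_of_map_le (R.φ i) hT (inf_le_inf_right U (R.reflect.x_le_y i))

protected theorem reflect : R.reflect.IsNegative := by
  have := hR.finite
  have := hR.finite_reflect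
  refine ⟨hR.finite_reflect, hR.nontrivial_reflect, fun U hU => ?_⟩
  have hsum := sum_finrank_reflect_y_inf_le U
  set T := ⨅ i, U.comap (R.φ i)
  have hT : ∀ i, T.map (R.φ i) ≤ R.reflect.y i ⊓ U := fun i =>
    le_inf LinearMap.map_le_range (Submodule.map_le_iff_le_comap.2 (iInf_le _ i))
  have hx := Finset.univ.sum_le_sum fun i _ => hR.finrank_le_of_map_φ_le (hT i)
  have hy := Finset.univ.sum_le_sum fun i _ => hR.finrank_add_finrank_reflect_x_inf_le (hT i)
  have hxy := Finset.univ.sum_le_sum fun i _ =>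
    Submodule.finrank_mono (inf_le_inf_right U (R.reflect.x_le_y i))
  have hU' : 0 < Module.finrank K U := Nat.pos_of_ne_zero fun h0 =>
    hU (Submodule.finrank_eq_zero.1 h0)
  simp only [Finset.sum_add_distrib, Finset.sum_const, Finset.card_univ, Fintype.card_fin,
    smul_eq_mul] at hx hy ⊢
  by_cases hT0 : T = ⊥
  · have hrank : Module.finrank K T = 0 := by rw [hT0]; exact finrank_bot K R.V
    omega
  · have hd := hR.defect T hT0
    rw [Finset.sum_add_distrib] at hd
    omega

end IsNegative

variable (R) in
/-- The iterated reflections of a representation. -/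
def tower : ℕ → Model.{u, v} K
  | 0 => R
  | n + 1 => (tower n).reflect

theorem IsNegative.tower (h : R.IsNegative) (n : ℕ) : (R.tower n).IsNegative := by
  induction n with
  | zero => exact h
  | succ n ih => exact ih.reflect

end Model

open Model

open scoped Function

theorem Tri.sum_univ {i j l : Fin 3} (h : Tri i j l) {M : Type*} [AddCommMonoid M]
    (v : Fin 3 → M) : ∑ t, v t = v i + v j + v l := by
  have huniv : (Finset.univ : Finset (Fin 3)) = {i, j, l} := by
    revert i j l; unfold Tri; decide
  rw [huniv, Finset.sum_insert (by simp [h.1, h.2.2]), Finset.sum_pair h.2.1, add_assoc]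

/-! ### Elementary maps and admissible elements -/

namespace Model

variable {K : Type u} [DivisionRing K] {R : Model.{u, v} K} {i j l : Fin 3}

theorem φ_add_add_eq_zero (h : Tri i j l) (w : R.V) : R.φ i w + R.φ j w + R.φ l w = 0 :=
  (h.sum_univ fun t => R.φ t w).symm.trans (R.sum_φ w)

theorem exists_φ_eq_of_add_add_eq_zero (h : Tri i j l) {p q r : R.reflect.V}
    (hp : p ∈ R.reflect.y i) (hq : q ∈ R.reflect.y j) (hr : r ∈ R.reflect.y l)
    (hsum : p + q + r = 0) : ∃ z, R.φ i z = p ∧ R.φ j z = q ∧ R.φ l z = r := by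
  let v : Fin 3 → R.reflect.V := fun t => if t = i then p else if t = j then q else r
  have hi : v i = p := if_pos rfl
  have hj : v j = q := by simp [v, h.1.symm]
  have hl : v l = r := by simp [v, h.2.2.symm, h.2.1.symm]
  have hv : ∀ t, v t ∈ R.reflect.y t := by
    intro t
    dsimp only [v]
    split_ifs with h₁ h₂
    · exact h₁ ▸ hp
    · exact h₂ ▸ hq
    · obtain rfl : t = l := by clear * - h h₁ h₂; revert i j l t; unfold Tri; decide
      exact hr
  obtain ⟨z, hz⟩ := exists_φ_preimages_of_sum_eq_zero hv (by rw [h.sum_univ, hi, hj, hl, hsum])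
  exact ⟨z, (hz i).trans hi, (hz j).trans hj, (hz l).trans hl⟩

theorem φ_apply_mem_reflect_y (i : Fin 3) (w : R.V) : R.φ i w ∈ R.reflect.y i := ⟨w, rfl⟩

theorem φ_apply_eq_neg_of_mem_x (h : Tri i j l) {w : R.V} (hw : w ∈ R.x j) :
    R.φ i w = -R.φ l w := by
  have hsum := φ_add_add_eq_zero h w
  rw [φ_apply_eq_zero hw, add_zero] at hsum
  exact eq_neg_of_add_eq_zero_left hsum

end Model

section Elementary

variable {K : Type u} [DivisionRing K] {R : Model.{u, v} K} {i j l : Fin 3}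

theorem map_φ_comap_inf (h : Tri i j l) (s₁ s₂ s₃ : D222) :
    ((R.reflect.ev s₁).comap (R.φ i) ⊓ (R.reflect.ev s₂).comap (R.φ j) ⊓
      (R.reflect.ev s₃).comap (R.φ l)).map (R.φ l) =
      R.reflect.ev (y l ⊓ s₃ ⊓ (y i ⊓ s₁ ⊔ y j ⊓ s₂)) := by
  ext v
  simp only [map_sup, map_inf, ev_y, Submodule.mem_sup, Submodule.mem_inf, Submodule.mem_map,
    Submodule.mem_comap]
  constructor
  · rintro ⟨w, ⟨⟨h₁, h₂⟩, h₃⟩, rfl⟩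
    refine ⟨⟨φ_apply_mem_reflect_y l w, h₃⟩,
      -R.φ i w, ⟨neg_mem (φ_apply_mem_reflect_y i w), neg_mem h₁⟩,
      -R.φ j w, ⟨neg_mem (φ_apply_mem_reflect_y j w), neg_mem h₂⟩, ?_⟩
    rw [eq_neg_of_add_eq_zero_right (φ_add_add_eq_zero h w), neg_add]
  · rintro ⟨⟨hl, h₃⟩, p, ⟨hp, h₁⟩, q, ⟨hq, h₂⟩, rfl⟩
    obtain ⟨z, hzi, hzj, hzl⟩ := exists_φ_eq_of_add_add_eq_zero h (neg_mem hp) (neg_mem hq) hl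
      (by abel)
    refine ⟨z, ⟨⟨?_, ?_⟩, ?_⟩, hzl⟩
    · exact hzi ▸ neg_mem h₁
    · exact hzj ▸ neg_mem h₂
    · exact hzl ▸ h₃

variable (hR : Pairwise (Disjoint on R.x))
include hR

theorem comap_φ_reflect_x (i : Fin 3) : (R.reflect.ev (x i)).comap (R.φ i) = R.ev (y i) :=
  Submodule.ext fun _ => φ_apply_mem_reflect_x_iff hR

theorem comap_φ_A (h : Tri i j l) (n : ℕ) :
    (R.reflect.ev (A n l j)).comap (R.φ i) = R.ev (a n i j) := by
  induction n generalizing i j l with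
  | zero => simp [a_zero, A_zero]
  | succ n ih =>
    have ih' (w : R.V) : R.φ j w ∈ R.reflect.ev (A n i l) ↔ w ∈ R.ev (a n j l) :=
      SetLike.ext_iff.1 (ih h.rot) w
    ext w
    simp only [a_succ h, A_succ h.rot.swap, map_sup, map_inf, ev_x, ev_y, Submodule.mem_sup,
      Submodule.mem_inf, Submodule.mem_comap]
    constructor
    · rintro ⟨p, hp, q, ⟨hq, hqA⟩, hpq⟩
      obtain ⟨z, hzi, hzj, -⟩ := exists_φ_eq_of_add_add_eq_zero h
        (neg_mem (φ_apply_mem_reflect_y i w)) (R.reflect.x_le_y j hq) hp (by rw [← hpq]; abel)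
      subst hzj
      refine ⟨w + z, ?_, -z, ⟨neg_mem ((φ_apply_mem_reflect_x_iff hR).1 hq),
        neg_mem ((ih' z).1 hqA)⟩, by abel⟩
      rw [← φ_apply_eq_zero_iff hR, map_add, hzi, add_neg_cancel]
    · rintro ⟨u, hu, v, ⟨hv, hva⟩, rfl⟩
      refine ⟨-R.φ l v, neg_mem (φ_apply_mem_reflect_y l v), -R.φ j v,
        ⟨neg_mem ((φ_apply_mem_reflect_x_iff hR).2 hv), neg_mem ((ih' v).2 hva)⟩, ?_⟩
      rw [map_add, φ_apply_eq_zero hu, zero_add, ← neg_add, add_comm,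
        ← eq_neg_of_add_eq_zero_left ((add_assoc _ _ _).symm.trans (φ_add_add_eq_zero h v))]

theorem comap_φ_a (h : Tri i j l) (n : ℕ) :
    (R.reflect.ev (a n i l)).comap (R.φ i) = R.ev (A n i j) := by
  induction n generalizing i j l with
  | zero => simp [a_zero, A_zero]
  | succ n ih =>
    have ih' (w : R.V) : R.φ l w ∈ R.reflect.ev (a n l j) ↔ w ∈ R.ev (A n l i) :=
      SetLike.ext_iff.1 (ih h.rot.rot) w
    ext w
    simp only [A_succ h, a_succ h.rot.rot.swap, map_sup, map_inf, ev_x, ev_y, Submodule.mem_sup,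
      Submodule.mem_inf, Submodule.mem_comap]
    constructor
    · rintro ⟨p, hp, q, ⟨hq, hqa⟩, hpq⟩
      obtain ⟨z, hzi, hzj, hzl⟩ := exists_φ_eq_of_add_add_eq_zero h (p := q) (q := 0) (r := -q)
        (eq_sub_of_add_eq' hpq ▸ sub_mem (φ_apply_mem_reflect_y i w) (R.reflect.x_le_y i hp))
        (zero_mem _) (neg_mem hq) (by abel)
      refine ⟨w - z, ?_, z, ⟨(φ_apply_eq_zero_iff hR).1 hzj, (ih' z).1 (hzl ▸ neg_mem hqa)⟩,
        sub_add_cancel w z⟩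
      rw [← φ_apply_mem_reflect_x_iff hR, map_sub, hzi, ← hpq, add_sub_cancel_right]
      exact hp
    · rintro ⟨u, hu, v, ⟨hv, hvA⟩, rfl⟩
      refine ⟨R.φ i u, (φ_apply_mem_reflect_x_iff hR).2 hu, R.φ i v, ?_, (map_add _ _ _).symm⟩
      rw [φ_apply_eq_neg_of_mem_x h hv]
      exact ⟨neg_mem (φ_apply_mem_reflect_y l v), neg_mem ((ih' v).2 hvA)⟩

theorem comap_φ_y_inf (h : Tri i j l) :
    (R.reflect.ev (y l)).comap (R.φ i) ⊓ (R.reflect.ev (y l)).comap (R.φ j) =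
      R.ev (x i ⊔ x j) := by
  ext w
  simp only [map_sup, ev_x, ev_y, Submodule.mem_sup, Submodule.mem_inf, Submodule.mem_comap]
  constructor
  · rintro ⟨hi, -⟩
    obtain ⟨z, hzi, hzj, -⟩ := exists_φ_eq_of_add_add_eq_zero h (φ_apply_mem_reflect_y i w)
      (zero_mem _) (neg_mem hi) (by abel)
    refine ⟨w - z, ?_, z, (φ_apply_eq_zero_iff hR).1 hzj, sub_add_cancel w z⟩
    rw [← φ_apply_eq_zero_iff hR, map_sub, hzi, sub_self]
  · rintro ⟨u, hu, v, hv, rfl⟩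
    rw [map_add, map_add, φ_apply_eq_zero hu, φ_apply_eq_zero hv, zero_add, add_zero,
      φ_apply_eq_neg_of_mem_x h hv, φ_apply_eq_neg_of_mem_x h.swap hu]
    exact ⟨neg_mem (φ_apply_mem_reflect_y l v), neg_mem (φ_apply_mem_reflect_y l u)⟩

theorem ev_eEven (h : Tri i j l) (α β γ δ : ℕ) : R.ev (eEven i j l α β γ δ) =
    (R.reflect.ev (a γ i j ⊓ A δ j l)).comap (R.φ i) ⊓
      (R.reflect.ev (x j ⊓ A β l i)).comap (R.φ j) ⊓
      (R.reflect.ev (a α l i)).comap (R.φ l) := by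
  simp only [eEven, map_inf, Submodule.comap_inf, comap_φ_reflect_x hR, comap_φ_A hR h.swap,
    comap_φ_A hR h.rot.rot.swap, comap_φ_a hR h.rot.swap, comap_φ_a hR h.rot.rot.swap]
  ac_rfl

theorem ev_eOdd (h : Tri i j l) (α β γ δ : ℕ) : R.ev (eOdd i j l α β γ δ) =
    (R.reflect.ev (a β i l ⊓ A γ l j)).comap (R.φ i) ⊓
      (R.reflect.ev (a δ j i)).comap (R.φ j) ⊓
      (R.reflect.ev (x l ⊓ A α j i)).comap (R.φ l) := by
  simp only [eOdd, map_inf, Submodule.comap_inf, comap_φ_reflect_x hR, comap_φ_A hR h,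
    comap_φ_A hR h.rot.rot, comap_φ_a hR h, comap_φ_a hR h.rot]
  ac_rfl

theorem ev_fEven (h : Tri i j l) (q k : ℕ) : R.ev (fEven i j l q k) =
    (R.reflect.ev (x i ⊓ A q j l)).comap (R.φ i) ⊓ (R.reflect.ev (x j)).comap (R.φ j) ⊓
      (R.reflect.ev (a k l i)).comap (R.φ l) := by
  simp only [fEven, map_inf, Submodule.comap_inf, comap_φ_reflect_x hR,
    comap_φ_A hR h.rot.rot.swap, comap_φ_a hR h.rot.swap]
  ac_rfl

theorem ev_fSum (h : Tri i j l) (q k : ℕ) : R.ev (fSum i j l q k) =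
    (R.reflect.ev (y l)).comap (R.φ i) ⊓ (R.reflect.ev (y l ⊓ a q j i)).comap (R.φ j) ⊓
      (R.reflect.ev (x l ⊓ A k j i)).comap (R.φ l) := by
  rw [fSum, map_inf, map_inf, map_inf, ← comap_φ_y_inf hR h]
  simp only [map_inf, Submodule.comap_inf, comap_φ_reflect_x hR, comap_φ_A hR h.rot.rot,
    comap_φ_a hR h.rot]
  ac_rfl

theorem ev_fSingle (hR' : Pairwise (Disjoint on R.reflect.x)) (h : Tri i j l) (q k : ℕ) :
    R.ev (fSingle i j l q k) =
      (R.reflect.ev (a q i l ⊓ A k l j)).comap (R.φ i) ⊓ (R.reflect.ev ⊤).comap (R.φ j) ⊓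
        (R.reflect.ev ⊥).comap (R.φ l) := by
  have hx : (R.reflect.ev ⊥).comap (R.φ l) = R.ev (x l) := by
    rw [ev_bot hR']
    exact Submodule.ext fun _ => φ_apply_eq_zero_iff hR
  simp only [fSingle, map_inf, Submodule.comap_inf, hx, comap_φ_A hR h, comap_φ_a hR h, ev_top,
    Submodule.comap_top, inf_top_eq]
  ac_rfl

theorem map_φ_eEven_third (h : Tri i j l) (α β γ δ : ℕ) :
    (R.ev (eEven i j l α β γ δ)).map (R.φ l) = R.reflect.ev (eOdd i j l α (β + 1) γ δ) := by
  have hU : x j ⊓ A β l i ≤ a γ i j ⊓ A δ j l :=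
    inf_le_left.trans (le_inf (x_right_le_a _ _ _) (x_le_A _ _ _))
  have hx := x_le_y j
  rw [ev_eEven hR h, map_φ_comap_inf h, inf_eq_right.2 (inf_le_left.trans hx), inf_comm (y i),
    inf_sup_assoc_of_le _ hU, ← A_succ h, eOdd]
  congr 1
  order

theorem map_φ_eEven_first (h : Tri i j l) (α β γ δ : ℕ) :
    (R.ev (eEven i j l α β γ δ)).map (R.φ i) = R.reflect.ev (eOdd j l i γ δ (α + 1) β) := by
  have hU : y l ⊓ a α l i ≤ A β l i := inf_le_left.trans (y_le_A _ _ _)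
  have hx := x_le_y j
  rw [ev_eEven hR h, inf_assoc, inf_comm, map_φ_comap_inf h.rot,
    inf_eq_right.2 (inf_le_left.trans hx), inf_comm (x j), inf_sup_assoc_of_le _ hU,
    ← a_succ h.rot, eOdd]
  congr 1
  order

theorem map_φ_eOdd_first (h : Tri i j l) (α β γ δ : ℕ) :
    (R.ev (eOdd i j l α β γ δ)).map (R.φ i) = R.reflect.ev (eEven l i j α β γ (δ + 1)) := by
  have hU : y j ⊓ a δ j i ≤ A α j i := inf_le_left.trans (y_le_A _ _ _)
  have hx := x_le_y l
  rw [ev_eOdd hR h, inf_assoc, inf_comm, map_φ_comap_inf h.rot,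
    inf_eq_right.2 (inf_le_left.trans hx), inf_comm (x l), sup_comm, inf_sup_assoc_of_le _ hU,
    ← a_succ h.rot.swap, eEven]
  congr 1
  order

theorem map_φ_eOdd_second (h : Tri i j l) (α β γ δ : ℕ) :
    (R.ev (eOdd i j l α β γ δ)).map (R.φ j) = R.reflect.ev (eEven i j l γ δ (α + 1) β) := by
  have hU : x l ⊓ A α j i ≤ a β i l ⊓ A γ l j :=
    inf_le_left.trans (le_inf (x_right_le_a _ _ _) (x_le_A _ _ _))
  have hx := x_le_y l
  rw [ev_eOdd hR h, inf_comm, ← inf_assoc, map_φ_comap_inf h.rot.rot,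
    inf_eq_right.2 (inf_le_left.trans hx), sup_comm, inf_comm (y i), inf_sup_assoc_of_le _ hU,
    ← A_succ h.rot.rot.swap, eEven]
  congr 1
  order

theorem map_φ_fEven_third (h : Tri i j l) (q k : ℕ) :
    (R.ev (fEven i j l q k)).map (R.φ l) = R.reflect.ev (fSum i j l q k) := by
  have hx := x_le_y i
  rw [ev_fEven hR h, map_φ_comap_inf h, inf_eq_right.2 (inf_le_left.trans hx),
    inf_eq_right.2 (x_le_y j), inf_comm (x i), inf_sup_assoc_of_le _ (x_le_A _ _ _), fSum]
  congr 1
  order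

theorem map_φ_fEven_first (h : Tri i j l) (q k : ℕ) :
    (R.ev (fEven i j l q k)).map (R.φ i) = R.reflect.ev (fSingle j l i q (k + 1)) := by
  have hx := x_le_y i
  rw [ev_fEven hR h, inf_assoc, inf_comm, map_φ_comap_inf h.rot,
    inf_eq_right.2 (inf_le_left.trans hx), inf_eq_right.2 (x_le_y j), ← a_succ h.rot, fSingle]

theorem map_φ_fEven_second (h : Tri i j l) (q k : ℕ) :
    (R.ev (fEven i j l q k)).map (R.φ j) = R.reflect.ev (fSingle l i j (q + 1) k) := by
  have hU : x i ⊓ A q j l ≤ a k l i := inf_le_left.trans (x_right_le_a _ _ _)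
  have hx := x_le_y i
  rw [ev_fEven hR h, inf_comm, ← inf_assoc, map_φ_comap_inf h.rot.rot,
    inf_eq_right.2 (inf_le_left.trans hx), inf_eq_right.2 (x_le_y j), inf_comm (y l),
    inf_sup_assoc_of_le _ hU, ← A_succ h.rot.rot, fSingle]
  congr 1
  order

theorem map_φ_fSum_first (h : Tri i j l) (q k : ℕ) :
    (R.ev (fSum i j l q k)).map (R.φ i) = R.reflect.ev (fEven l i j (q + 1) k) := by
  have hU : y j ⊓ a q j i ≤ A k j i := inf_le_left.trans (y_le_A _ _ _)
  have hx := x_le_y l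
  have hxA : A k j i ⊓ x l ≤ y l := inf_le_right.trans hx
  rw [ev_fSum hR h, inf_assoc, inf_comm, map_φ_comap_inf h.rot,
    inf_eq_right.2 (inf_le_left.trans hx), inf_comm (x l), inf_left_comm,
    inf_sup_assoc_of_le _ hxA, sup_comm, inf_sup_assoc_of_le _ hU, ← a_succ h.rot.swap, fEven]
  congr 1
  order

theorem map_φ_fSum_second (h : Tri i j l) (q k : ℕ) :
    (R.ev (fSum i j l q k)).map (R.φ j) = R.reflect.ev (fEven j l i q (k + 1)) := by
  have hx := x_le_y l
  have hU : x l ⊓ A k j i ≤ y l := inf_le_left.trans hx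
  rw [ev_fSum hR h, inf_comm, ← inf_assoc, map_φ_comap_inf h.rot.rot, inf_eq_right.2 hU,
    sup_comm, inf_comm (y i), inf_sup_assoc_of_le _ hU, ← A_succ h.rot.rot.swap, fEven]
  congr 1
  order

theorem map_φ_fSingle_first (hR' : Pairwise (Disjoint on R.reflect.x)) (h : Tri i j l) (q k : ℕ) :
    (R.ev (fSingle i j l q k)).map (R.φ i) = R.reflect.ev (fEven i j l q k) := by
  rw [ev_fSingle hR hR' h, inf_assoc, inf_comm, map_φ_comap_inf h.rot, inf_bot_eq, sup_bot_eq,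
    inf_top_eq, fEven]
  congr 1
  order

theorem map_φ_fSingle_second (hR' : Pairwise (Disjoint on R.reflect.x)) (h : Tri i j l) (q k : ℕ) :
    (R.ev (fSingle i j l q k)).map (R.φ j) = R.reflect.ev (fEven i j l q k) := by
  rw [ev_fSingle hR hR' h, inf_comm, ← inf_assoc, map_φ_comap_inf h.rot.rot, inf_bot_eq,
    bot_sup_eq, inf_top_eq, fEven]
  congr 1
  order

end Elementary

/-! ### The symmetry of the types 7 and 8 -/

theorem inf_A_eq_inf_a {i j l : Fin 3} (h : Tri i j l) {n : ℕ} {T : D222} (hT : T ≤ a n i l) :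
    T ⊓ A (n + 1) i j = T ⊓ a (n + 1) j i := by
  induction n generalizing i j l T with
  | zero => rw [A_succ h, a_succ h.swap, A_zero, a_zero, inf_top_eq, inf_top_eq, sup_comm]
  | succ n ih =>
    have hx : x j ⊓ A (n + 1) l i = x j ⊓ a (n + 1) i l := ih h.rot.rot (x_right_le_a n l j)
    have hmod : a (n + 1) i l ⊓ A (n + 2) i j = a (n + 1) i l ⊓ a (n + 2) j i := by
      rw [A_succ h, a_succ h.swap, hx, ← inf_sup_assoc_of_le _ inf_le_right,
        ← inf_sup_assoc_of_le _ inf_le_right]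
      ac_rfl
    rw [← inf_eq_left.2 hT, inf_assoc, hmod, inf_assoc]

theorem le_A_succ_iff_le_a_succ {i j l : Fin 3} (h : Tri i j l) {n : ℕ} {T : D222}
    (hT : T ≤ a n i l) : T ≤ A (n + 1) i j ↔ T ≤ a (n + 1) j i := by
  rw [← inf_eq_left, inf_A_eq_inf_a h hT, inf_eq_left]

theorem le_a_of_le_A {i j l : Fin 3} (h : Tri i j l) {k : ℕ} {T : D222} (hy : T ≤ y l)
    (hij : T ≤ A k i j) (hjl : T ≤ A k j l) : T ≤ a k l j ∧ T ≤ a k j i := by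
  induction k with
  | zero => exact ⟨le_top, le_top⟩
  | succ k ih =>
    obtain ⟨hlj, hji⟩ := ih (hij.trans (A_succ_le _ _ _)) (hjl.trans (A_succ_le _ _ _))
    have hil : T ≤ a k i l := (le_inf hy hlj).trans (y_inf_a_le_a h.rot.rot k)
    exact ⟨(le_A_succ_iff_le_a_succ h.rot hji).1 hjl, (le_A_succ_iff_le_a_succ h hil).1 hij⟩

theorem fSingle_swap {i j l : Fin 3} (h : Tri i j l) (k : ℕ) :
    fSingle i j l k k = fSingle j i l k k := by
  cases k with
  | zero => rfl
  | succ k =>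
    rw [fSingle, fSingle, inf_A_eq_inf_a (l := l) h (x_right_le_a _ _ _),
      inf_A_eq_inf_a (l := l) h.swap (x_right_le_a _ _ _), inf_right_comm]

theorem fSum_swap {i j l : Fin 3} (h : Tri i j l) (k : ℕ) :
    fSum i j l k k = fSum j i l k k := by
  cases k with
  | zero => simp only [fSum, A_zero, a_zero, sup_comm]
  | succ k =>
    have hji : y l ⊓ (x i ⊔ x j) ≤ a k j i :=
      inf_le_right.trans (sup_le (x_right_le_a k j i) (x_le_a k j i))
    have hij : y l ⊓ (x i ⊔ x j) ≤ a k i j :=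
      inf_le_right.trans (sup_le (x_le_a k i j) (x_right_le_a k i j))
    rw [fSum, fSum, sup_comm (x j), inf_A_eq_inf_a h.rot hji, inf_A_eq_inf_a h.rot.rot.swap hij,
      inf_right_comm]

theorem a_antitone (i j : Fin 3) : Antitone fun n => a n i j :=
  antitone_nat_of_succ_le fun n => a_succ_le n i j

theorem A_antitone (i j : Fin 3) : Antitone fun n => A n i j :=
  antitone_nat_of_succ_le fun n => A_succ_le n i j

theorem le_A_of_le_a {i j l : Fin 3} (h : Tri i j l) {k m : ℕ} (hkm : k ≤ m + 1) {T : D222}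
    (hil : T ≤ a m i l) (hji : T ≤ a k j i) : T ≤ A k i j := by
  cases k with
  | zero => exact le_top
  | succ k =>
    exact (le_A_succ_iff_le_a_succ h (hil.trans (a_antitone i l (by omega)))).2 hji

theorem eOdd_le_eOdd_swap {i j l : Fin 3} (h : Tri i j l) {k m : ℕ} (hkm : k ≤ m)
    (hmk : m ≤ k + 1) : eOdd i j l k m m k ≤ eOdd j i l k m m k := by
  set T := eOdd i j l k m m k with hT
  obtain ⟨⟨⟨⟨hy, hli⟩, hAij⟩, haij⟩, hAjl⟩ :
    (((T ≤ y l ∧ T ≤ a k l i) ∧ T ≤ A m i j) ∧ T ≤ a m i j) ∧ T ≤ A k j l := by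
    simp only [← le_inf_iff, hT, eOdd, le_rfl]
  have hjl : T ≤ a k j l := (le_inf hy hli).trans (y_inf_a_le_a h.rot.swap k)
  obtain ⟨hlj, hji⟩ := le_a_of_le_A h hy (hAij.trans (A_antitone i j hkm)) hAjl
  have hil : T ≤ a k i l := (le_inf hy hlj).trans (y_inf_a_le_a h.rot.rot k)
  have hji' : T ≤ a m j i := by
    obtain rfl | rfl : m = k ∨ m = k + 1 := by omega
    · exact hji
    · exact (le_A_succ_iff_le_a_succ h hil).1 hAij
  have hAji : T ≤ A m j i := le_A_of_le_a h.swap hmk hjl haij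
  have hAil : T ≤ A k i l := le_A_of_le_a h.rot.rot.swap (by omega) haij hli
  exact le_inf (le_inf (le_inf (le_inf hy hlj) hAji) hji') hAil

theorem eOdd_swap {i j l : Fin 3} (h : Tri i j l) {k m : ℕ} (hkm : k ≤ m) (hmk : m ≤ k + 1) :
    eOdd i j l k m m k = eOdd j i l k m m k :=
  le_antisymm (eOdd_le_eOdd_swap h hkm hmk) (eOdd_le_eOdd_swap h.swap hkm hmk)

theorem f_swap {i j l : Fin 3} (h : Tri i j l) {r : Fin 14} (hr : r = 6 ∨ r = 7) (k p : ℕ) :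
    f i l j k p r = f i j l k p r := by
  rw [f_eq, f_eq]
  rcases hr with rfl | rfl
  exacts [fSingle_swap h.rot.swap k, fSum_swap h.rot.swap k]

theorem e_swap {i j l : Fin 3} (h : Tri i j l) {r : Fin 14} (hr : r = 6 ∨ r = 7) (k p : ℕ) :
    e i l j k p r = e i j l k p r := by
  rw [e_eq, e_eq]
  rcases hr with rfl | rfl
  exacts [eOdd_swap h.rot.swap le_rfl k.le_succ, eOdd_swap h.rot.swap k.le_succ le_rfl]

/-! ### Elementary maps and types of admissible sequences -/

/-- The effect of the elementary maps on the types `(r, k, p)` of admissible sequences: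
`Arrow c (r, k, p) (r', k', p')` says that `φ_i`, `φ_j` or `φ_l`, for `c = 0, 1, 2`, carries the
element of type `(r, k, p)` to the element of type `(r', k', p')`. The constructors use the
numbering of the types in the paper, which starts with one. -/
inductive Arrow : Fin 3 → Fin 14 × ℕ × ℕ → Fin 14 × ℕ × ℕ → Prop
  | one_two (k p : ℕ) : Arrow 2 (0, k + 1, p) (1, k + 1, p)
  | two_three (k p : ℕ) : Arrow 0 (1, k + 1, p) (2, k + 1, p)
  | three_four (k p : ℕ) : Arrow 1 (2, k + 1, p) (3, k + 1, p)
  | four_five (k p : ℕ) : Arrow 2 (3, k + 1, p) (4, k + 1, p)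
  | five_six (k p : ℕ) : Arrow 0 (4, k + 1, p) (5, k + 1, p)
  | six_one (k p : ℕ) : Arrow 1 (5, k + 1, p) (0, k + 1, p + 1)
  | seven_nine (k p : ℕ) : Arrow 1 (6, k, p) (8, k, 0)
  | eight_one (k p : ℕ) : Arrow 1 (7, k, p) (0, k + 1, 0)
  | nine_ten (k p : ℕ) : Arrow 2 (8, k, p) (9, k, p)
  | ten_eleven (k p : ℕ) : Arrow 0 (9, k, p) (10, k, p)
  | eleven_twelve (k p : ℕ) : Arrow 1 (10, k, p) (11, k, p)
  | twelve_thirteen (k p : ℕ) : Arrow 2 (11, k, p) (12, k, p)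
  | thirteen_fourteen (k p : ℕ) : Arrow 0 (12, k, p) (13, k, p)
  | fourteen_nine (k p : ℕ) : Arrow 1 (13, k, p) (8, k, p + 1)
  | one_fourteen (k p : ℕ) : Arrow 0 (0, k + 1, p + 1) (13, k + 1, p)
  | one_seven (k p : ℕ) : Arrow 0 (0, k + 1, 0) (6, k + 1, p)
  | two_nine (k p : ℕ) : Arrow 1 (1, k + 1, p) (8, k + 1, p)
  | three_ten (k p : ℕ) : Arrow 2 (2, k + 1, p) (9, k + 1, p)
  | four_eleven (k p : ℕ) : Arrow 0 (3, k + 1, p) (10, k + 1, p)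
  | five_twelve (k p : ℕ) : Arrow 1 (4, k + 1, p) (11, k + 1, p)
  | six_thirteen (k p : ℕ) : Arrow 2 (5, k + 1, p) (12, k + 1, p)
  | nine_six (k p : ℕ) : Arrow 0 (8, k, p + 1) (5, k + 1, p)
  | nine_eight (k p : ℕ) : Arrow 0 (8, k, 0) (7, k, p)
  | ten_one (k p : ℕ) : Arrow 1 (9, k, p) (0, k + 1, p)
  | eleven_two (k p : ℕ) : Arrow 2 (10, k, p) (1, k + 1, p)
  | twelve_three (k p : ℕ) : Arrow 0 (11, k, p) (2, k + 1, p)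
  | thirteen_four (k p : ℕ) : Arrow 1 (12, k, p) (3, k + 1, p)
  | fourteen_five (k p : ℕ) : Arrow 2 (13, k, p) (4, k + 1, p)

section ElementaryMap

variable {K : Type u} [DivisionRing K] {R : Model.{u, v} K} (hR : Pairwise (Disjoint on R.x))
  {c : Fin 3} {s s' : Fin 14 × ℕ × ℕ} (σ : Equiv.Perm (Fin 3))
include hR

theorem map_φ_f (hR' : Pairwise (Disjoint on R.reflect.x)) (hc : Arrow c s s') :
    (R.ev (f (σ 0) (σ 1) (σ 2) s.2.1 s.2.2 s.1)).map (R.φ (σ c)) =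
      R.reflect.ev (f (σ 0) (σ 1) (σ 2) s'.2.1 s'.2.2 s'.1) := by
  have h := tri_perm σ
  cases hc <;> simp only [f_eq, Nat.add_right_comm _ 1 (3 * _)]
  exacts [map_φ_fEven_third hR h _ _, map_φ_fSum_first hR h _ _,
    map_φ_fEven_third hR h.rot.rot _ _, map_φ_fSum_first hR h.rot.rot _ _,
    map_φ_fEven_third hR h.rot _ _, map_φ_fSum_first hR h.rot _ _,
    map_φ_fSingle_first hR hR' h.rot _ _, map_φ_fSum_first hR h.rot _ _,
    map_φ_fEven_second hR h.rot _ _, map_φ_fSingle_first hR hR' h _ _,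
    map_φ_fEven_second hR h _ _, map_φ_fSingle_first hR hR' h.rot.rot _ _,
    map_φ_fEven_second hR h.rot.rot _ _, map_φ_fSingle_first hR hR' h.rot _ _,
    map_φ_fEven_first hR h _ _, map_φ_fEven_first hR h _ _, map_φ_fSum_second hR h _ _,
    map_φ_fEven_first hR h.rot.rot _ _, map_φ_fSum_second hR h.rot.rot _ _,
    map_φ_fEven_first hR h.rot _ _, map_φ_fSum_second hR h.rot _ _,
    map_φ_fEven_third hR h.rot _ _, map_φ_fEven_third hR h.rot _ _,
    map_φ_fSingle_second hR hR' h _ _, map_φ_fEven_third hR h _ _,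
    map_φ_fSingle_second hR hR' h.rot.rot _ _, map_φ_fEven_third hR h.rot.rot _ _,
    map_φ_fSingle_second hR hR' h.rot _ _]

theorem map_φ_e (hc : Arrow c s s') :
    (R.ev (e (σ 0) (σ 1) (σ 2) s.2.1 s.2.2 s.1)).map (R.φ (σ c)) =
      R.reflect.ev (e (σ 0) (σ 1) (σ 2) s'.2.1 s'.2.2 s'.1) := by
  have h := tri_perm σ
  cases hc <;> simp only [e_eq, Nat.add_right_comm _ 1 (3 * _)]
  exacts [map_φ_eEven_third hR h _ _ _ _, map_φ_eOdd_first hR h _ _ _ _,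
    map_φ_eEven_third hR h.rot.rot _ _ _ _, map_φ_eOdd_first hR h.rot.rot _ _ _ _,
    map_φ_eEven_third hR h.rot _ _ _ _, map_φ_eOdd_first hR h.rot _ _ _ _,
    map_φ_eOdd_first hR h.rot _ _ _ _, map_φ_eOdd_first hR h.rot _ _ _ _,
    map_φ_eEven_third hR h _ _ _ _, map_φ_eOdd_first hR h _ _ _ _,
    map_φ_eEven_third hR h.rot.rot _ _ _ _, map_φ_eOdd_first hR h.rot.rot _ _ _ _,
    map_φ_eEven_third hR h.rot _ _ _ _, map_φ_eOdd_first hR h.rot _ _ _ _,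
    map_φ_eEven_first hR h _ _ _ _, map_φ_eEven_first hR h _ _ _ _,
    map_φ_eOdd_second hR h _ _ _ _, map_φ_eEven_first hR h.rot.rot _ _ _ _,
    map_φ_eOdd_second hR h.rot.rot _ _ _ _, map_φ_eEven_first hR h.rot _ _ _ _,
    map_φ_eOdd_second hR h.rot _ _ _ _, map_φ_eEven_first hR h _ _ _ _,
    map_φ_eEven_first hR h _ _ _ _, map_φ_eOdd_second hR h _ _ _ _,
    map_φ_eEven_first hR h.rot.rot _ _ _ _, map_φ_eOdd_second hR h.rot.rot _ _ _ _,
    map_φ_eEven_first hR h.rot _ _ _ _, map_φ_eOdd_second hR h.rot _ _ _ _]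

end ElementaryMap

/-- The normalization `p = 0` of the parameters of the types 7 and 8, which do not depend on `p`. -/
@[simp]
def Reduced (s : Fin 14 × ℕ × ℕ) : Prop := s.1 = 6 ∨ s.1 = 7 → s.2.2 = 0

theorem mem_params_of_len_eq (σ : Equiv.Perm (Fin 3)) {r : Fin 14} {k p n : ℕ}
    (hk : r < 6 → 0 < k) (hp : Reduced (r, k, p)) (hlen : len k p r = n) :
    (σ, r, k, p) ∈ params (σ 0) n := by
  refine mem_params.2 ⟨?_, rfl, hk, hlen⟩
  fin_cases r <;> simp [len] at hp hlen ⊢ <;> omega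

theorem Arrow.pos_left {c : Fin 3} {s s' : Fin 14 × ℕ × ℕ} (hc : Arrow c s s') :
    s.1 < 6 → 0 < s.2.1 := by
  cases hc <;> simp [Fin.lt_def]

theorem Arrow.pos_right {c : Fin 3} {s s' : Fin 14 × ℕ × ℕ} (hc : Arrow c s s') :
    s'.1 < 6 → 0 < s'.2.1 := by
  cases hc <;> simp [Fin.lt_def]

theorem Arrow.len_eq {c : Fin 3} {s s' : Fin 14 × ℕ × ℕ} (hc : Arrow c s s') :
    len s'.2.1 s'.2.2 s'.1 = len s.2.1 s.2.2 s.1 + 1 := by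
  cases hc <;> simp [len] <;> ring

theorem Arrow.mem_params_left {c : Fin 3} {s s' : Fin 14 × ℕ × ℕ} (hc : Arrow c s s')
    (hp : Reduced s) {σ : Equiv.Perm (Fin 3)} {t : Fin 3} {n : ℕ}
    (hs' : (σ, s') ∈ params t (n + 1)) : (σ, s) ∈ params t n := by
  obtain ⟨-, rfl, -, hlen⟩ := mem_params.1 hs'
  exact mem_params_of_len_eq σ hc.pos_left hp (Nat.succ_injective (hc.len_eq.symm.trans hlen))

theorem Arrow.mem_params_right {c : Fin 3} {s s' : Fin 14 × ℕ × ℕ} (hc : Arrow c s s')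
    (hp : Reduced s') {σ : Equiv.Perm (Fin 3)} {t : Fin 3} {n : ℕ}
    (hs : (σ, s) ∈ params t n) : (σ, s') ∈ params t (n + 1) := by
  obtain ⟨-, rfl, -, hlen⟩ := mem_params.1 hs
  exact mem_params_of_len_eq σ hc.pos_right hp (hc.len_eq.trans (congrArg (· + 1) hlen))

theorem exists_arrow_to {r : Fin 14} {k : ℕ} (p : ℕ) (hk : r < 6 → 0 < k)
    (h₆ : ¬(r = 6 ∧ k = 0)) : ∃ c s, Arrow c s (r, k, p) ∧ Reduced s := by
  by_cases hr : r < 6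
  · obtain ⟨k, rfl⟩ := Nat.exists_eq_succ_of_ne_zero (hk hr).ne'
    fin_cases r <;> first | exact absurd hr (by decide) | skip
    exacts [⟨_, _, .ten_one k p, by simp⟩, ⟨_, _, .one_two k p, by simp⟩,
      ⟨_, _, .two_three k p, by simp⟩, ⟨_, _, .three_four k p, by simp⟩,
      ⟨_, _, .four_five k p, by simp⟩, ⟨_, _, .five_six k p, by simp⟩]
  · fin_cases r <;> first | exact absurd (by decide) hr | skip
    · obtain ⟨k, rfl⟩ := Nat.exists_eq_succ_of_ne_zero fun hk₀ => h₆ ⟨rfl, hk₀⟩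
      exact ⟨_, _, .one_seven k p, by simp⟩
    · exact ⟨_, _, .nine_eight k p, by simp⟩
    · cases p with
      | zero => exact ⟨_, _, .seven_nine k 0, by simp⟩
      | succ p => exact ⟨_, _, .fourteen_nine k p, by simp⟩
    exacts [⟨_, _, .nine_ten k p, by simp⟩, ⟨_, _, .ten_eleven k p, by simp⟩,
      ⟨_, _, .eleven_twelve k p, by simp⟩, ⟨_, _, .twelve_thirteen k p, by simp⟩,
      ⟨_, _, .thirteen_fourteen k p, by simp⟩]

theorem exists_two_arrows {r : Fin 14} {k : ℕ} (p : ℕ) (hk : r < 6 → 0 < k) (h₆ : r ≠ 6)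
    (h₇ : r ≠ 7) : ∃ c c' s s', c ≠ c' ∧ Arrow c (r, k, p) s ∧ Arrow c' (r, k, p) s' ∧
      Reduced s ∧ Reduced s' := by
  by_cases hr : r < 6
  · obtain ⟨k, rfl⟩ := Nat.exists_eq_succ_of_ne_zero (hk hr).ne'
    fin_cases r <;> first | exact absurd hr (by decide) | skip
    · cases p with
      | zero => exact ⟨_, _, _, _, by decide, .one_two k 0, .one_seven k 0, by simp, by simp⟩
      | succ p =>
        exact ⟨_, _, _, _, by decide, .one_two k _, .one_fourteen k p, by simp, by simp⟩
    exacts [⟨_, _, _, _, by decide, .two_three k p, .two_nine k p, by simp, by simp⟩,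
      ⟨_, _, _, _, by decide, .three_four k p, .three_ten k p, by simp, by simp⟩,
      ⟨_, _, _, _, by decide, .four_five k p, .four_eleven k p, by simp, by simp⟩,
      ⟨_, _, _, _, by decide, .five_six k p, .five_twelve k p, by simp, by simp⟩,
      ⟨_, _, _, _, by decide, .six_one k p, .six_thirteen k p, by simp, by simp⟩]
  · fin_cases r <;> first | exact absurd (by decide) hr | contradiction | skip
    · cases p with
      | zero => exact ⟨_, _, _, _, by decide, .nine_ten k 0, .nine_eight k 0, by simp, by simp⟩
      | succ p => exact ⟨_, _, _, _, by decide, .nine_ten k _, .nine_six k p, by simp, by simp⟩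
    exacts [⟨_, _, _, _, by decide, .ten_eleven k p, .ten_one k p, by simp, by simp⟩,
      ⟨_, _, _, _, by decide, .eleven_twelve k p, .eleven_two k p, by simp, by simp⟩,
      ⟨_, _, _, _, by decide, .twelve_thirteen k p, .twelve_three k p, by simp, by simp⟩,
      ⟨_, _, _, _, by decide, .thirteen_fourteen k p, .thirteen_four k p, by simp, by simp⟩,
      ⟨_, _, _, _, by decide, .fourteen_nine k p, .fourteen_five k p, by simp, by simp⟩]

theorem exists_arrow_one {r : Fin 14} (hr : r = 6 ∨ r = 7) (k p : ℕ) :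
    ∃ s, Arrow 1 (r, k, p) s ∧ Reduced s := by
  rcases hr with rfl | rfl
  exacts [⟨_, .seven_nine k p, by simp⟩, ⟨_, .eight_one k p, by simp⟩]

/-! ### Propagation of vanishing and totality along reflections -/

section Propagation

variable {K : Type u} [DivisionRing K]

theorem Model.map_φ_le_of_ne {R : Model.{u, v} K} {S : Submodule K R.V}
    {B : Submodule K R.reflect.V} {c c' : Fin 3} (hcc' : c ≠ c') (hc : S.map (R.φ c) ≤ B)
    (hc' : S.map (R.φ c') ≤ B) (d : Fin 3) : S.map (R.φ d) ≤ B := by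
  by_cases hdc : d = c
  · exact hdc ▸ hc
  by_cases hdc' : d = c'
  · exact hdc' ▸ hc'
  rw [Submodule.map_le_iff_le_comap] at hc hc' ⊢
  intro w hw
  have hsum := φ_add_add_eq_zero (R := R) ⟨hcc', Ne.symm hdc', Ne.symm hdc⟩ w
  rw [Submodule.mem_comap, eq_neg_of_add_eq_zero_right hsum]
  exact neg_mem (add_mem (hc hw) (hc' hw))

theorem Model.ev_finset_sup {R : Model.{u, v} K} (hR : Pairwise (Disjoint on R.x)) {ι : Type*}
    (s : Finset ι) (g : ι → D222) : R.ev (s.sup g) = s.sup fun i => R.ev (g i) :=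
  Finset.apply_sup_eq_sup_comp R.ev (map_sup R.ev) (ev_bot hR)

/-- The properties of `f_α` and `e_α`, as functions of the parameters of `α`, on which the behaviour
of the cumulative elements under reflection depends. -/
structure IsElementary (K : Type u) [DivisionRing K]
    (g : Equiv.Perm (Fin 3) × Fin 14 × ℕ × ℕ → D222) : Prop where
  map_φ {R : Model.{u, v} K} (hR : Pairwise (Disjoint on R.x))
    (hR' : Pairwise (Disjoint on R.reflect.x)) {c : Fin 3} {s s' : Fin 14 × ℕ × ℕ}
    (σ : Equiv.Perm (Fin 3)) (hc : Arrow c s s') :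
    (R.ev (g (σ, s))).map (R.φ (σ c)) = R.reflect.ev (g (σ, s'))
  swap (σ : Equiv.Perm (Fin 3)) {r : Fin 14} (hr : r = 6 ∨ r = 7) (k p : ℕ) :
    g (σ * Equiv.swap 1 2, r, k, p) = g (σ, r, k, p)

theorem isElementary_f : IsElementary.{u, v} K
    fun s => f (s.1 0) (s.1 1) (s.1 2) s.2.2.1 s.2.2.2 s.2.1 where
  map_φ hR hR' _ _ _ σ hc := map_φ_f hR σ hR' hc
  swap σ _ hr k p := by
    simpa [Equiv.swap_apply_of_ne_of_ne] using f_swap (tri_perm σ) hr k p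

theorem isElementary_e : IsElementary.{u, v} K
    fun s => e (s.1 0) (s.1 1) (s.1 2) s.2.2.1 s.2.2.2 s.2.1 where
  map_φ hR _ _ _ _ σ hc := map_φ_e hR σ hc
  swap σ _ hr k p := by
    simpa [Equiv.swap_apply_of_ne_of_ne] using e_swap (tri_perm σ) hr k p

namespace IsElementary

variable {R : Model.{u, v} K} (hR : Pairwise (Disjoint on R.x))
  (hR' : Pairwise (Disjoint on R.reflect.x))
  {g : Equiv.Perm (Fin 3) × Fin 14 × ℕ × ℕ → D222} (hg : IsElementary.{u, v} K g)
  {t : Fin 3} {n : ℕ}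
include hg hR hR'

theorem map_φ_le_ev_sup {σ : Equiv.Perm (Fin 3)} {c : Fin 3} {s s' : Fin 14 × ℕ × ℕ}
    (hc : Arrow c s s') (hs' : (σ, s') ∈ params t n) :
    (R.ev (g (σ, s))).map (R.φ (σ c)) ≤ R.reflect.ev ((params t n).sup g) :=
  (hg.map_φ hR hR' σ hc).le.trans (OrderHomClass.mono R.reflect.ev (Finset.le_sup hs'))

theorem map_φ_le_ev_sup_succ {s : Equiv.Perm (Fin 3) × Fin 14 × ℕ × ℕ} (hs : s ∈ params t n)
    (d : Fin 3) : (R.ev (g s)).map (R.φ d) ≤ R.reflect.ev ((params t (n + 1)).sup g) := by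
  obtain ⟨σ, r, k, p⟩ := s
  by_cases hr : r = 6 ∨ r = 7
  · obtain ⟨s', hc, hs'⟩ := exists_arrow_one hr k p
    have hτ : (σ * Equiv.swap 1 2, r, k, p) ∈ params t n := by
      rw [mem_params] at hs ⊢
      simpa [Equiv.swap_apply_of_ne_of_ne] using hs
    have h₂ := map_φ_le_ev_sup hR hR' hg hc (hc.mem_params_right hs' hτ)
    rw [hg.swap σ hr, Equiv.Perm.mul_apply, Equiv.swap_apply_left] at h₂
    exact map_φ_le_of_ne (tri_perm σ).2.1
      (map_φ_le_ev_sup hR hR' hg hc (hc.mem_params_right hs' hs)) h₂ d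
  · rw [not_or] at hr
    obtain ⟨c, c', s₁, s₂, hcc', hc, hc', hs₁, hs₂⟩ :=
      exists_two_arrows p (mem_params.1 hs).2.2.1 hr.1 hr.2
    exact map_φ_le_of_ne (σ.injective.ne hcc')
      (map_φ_le_ev_sup hR hR' hg hc (hc.mem_params_right hs₁ hs))
      (map_φ_le_ev_sup hR hR' hg hc' (hc'.mem_params_right hs₂ hs)) d

theorem ev_reflect_eq_top (htop : R.ev ((params t n).sup g) = ⊤) :
    R.reflect.ev ((params t (n + 1)).sup g) = ⊤ := by
  rw [eq_top_iff, ← R.iSup_range_φ]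
  refine iSup_le fun d => ?_
  rw [LinearMap.range_eq_map, ← htop, ev_finset_sup hR, Submodule.map_le_iff_le_comap]
  exact Finset.sup_le fun s hs =>
    Submodule.map_le_iff_le_comap.1 (map_φ_le_ev_sup_succ hR hR' hg hs d)

theorem ev_reflect_eq_bot (hn : 0 < n) (hbot : R.ev ((params t n).sup g) = ⊥) :
    R.reflect.ev ((params t (n + 1)).sup g) = ⊥ := by
  rw [ev_finset_sup hR, Finset.sup_eq_bot_iff] at hbot
  rw [ev_finset_sup hR', Finset.sup_eq_bot_iff]
  rintro ⟨σ, r, k, p⟩ hs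
  obtain ⟨-, -, hk, hlen⟩ := mem_params.1 hs
  have hr : ¬(r = 6 ∧ k = 0) := by
    rintro ⟨rfl, rfl⟩
    exact hn.ne (Nat.succ_injective hlen)
  obtain ⟨c, s, hc, hs₀⟩ := exists_arrow_to p hk hr
  rw [← hg.map_φ hR hR' σ hc, hbot _ (hc.mem_params_left hs₀ hs), Submodule.map_bot]

end IsElementary

end Propagation

section Tower

variable {K : Type u} [DivisionRing K] {R : Model.{u, v} K} (hR : R.IsNegative)
  {g : Equiv.Perm (Fin 3) × Fin 14 × ℕ × ℕ → D222} (hg : IsElementary.{u, v} K g) {t : Fin 3}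
include hR

include hg in
theorem ev_tower_sup_eq_top (htop : R.ev ((params t 1).sup g) = ⊤) (n : ℕ) :
    (R.tower n).ev ((params t (n + 1)).sup g) = ⊤ := by
  induction n with
  | zero => exact htop
  | succ n ih => exact hg.ev_reflect_eq_top (hR.tower n).disjoint_x (hR.tower (n + 1)).disjoint_x ih

include hg in
theorem ev_tower_sup_eq_bot {m : ℕ} (hm : 0 < m) (hbot : R.ev ((params t m).sup g) = ⊥) (n : ℕ) :
    (R.tower n).ev ((params t (n + m)).sup g) = ⊥ := by
  induction n with
  | zero => rwa [Nat.zero_add]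
  | succ n ih =>
    rw [Nat.add_right_comm]
    exact hg.ev_reflect_eq_bot (hR.tower n).disjoint_x (hR.tower (n + 1)).disjoint_x (by omega) ih

theorem ev_tower_cumX_self_eq_bot (hy : R.y t = ⊥) (n : ℕ) :
    (R.tower n).ev (cumX t n) = ⊥ := by
  induction n with
  | zero => rw [cumX_zero]; exact ev_bot hR.disjoint_x
  | succ n ih =>
    cases n with
    | zero => rw [cumX_one, ev_x, tower, tower, reflect_x, hy, Submodule.map_bot]
    | succ n =>
      exact isElementary_f.ev_reflect_eq_bot (hR.tower (n + 1)).disjoint_x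
        (hR.tower (n + 2)).disjoint_x n.succ_pos ih

end Tower

/-! ### One-dimensional representations -/

section Line

variable {K : Type*} [DivisionRing K] (c : Fin 3) (X : Submodule K K)

/-- The one-dimensional representation in which `y_c` is the whole space, `x_c` is `X`, and the
other subspaces vanish. -/
def line : Model K where
  V := K
  x := Function.update ⊥ c X
  y := Function.update ⊥ c ⊤
  x_le_y := Function.update_mono le_top

variable {c X}

@[simp] theorem line_x_of_ne {i : Fin 3} (hic : i ≠ c) : (line c X).x i = ⊥ :=
  Function.update_of_ne hic _ _

@[simp] theorem line_y_of_ne {i : Fin 3} (hic : i ≠ c) : (line c X).y i = ⊥ :=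
  Function.update_of_ne hic _ _

@[simp] theorem line_y_self : (line c X).y c = ⊤ := Function.update_self ..

@[simp] theorem line_top_x_self : (line c (⊤ : Submodule K K)).x c = ⊤ := Function.update_self ..

@[simp] theorem line_bot_x_self : (line c (⊥ : Submodule K K)).x c = ⊥ := Function.update_self ..

variable (c X)

theorem line_isNegative : (line c X).IsNegative where
  finite := inferInstanceAs (Module.Finite K K)
  nontrivial := inferInstanceAs (Nontrivial K)
  defect U hU := by
    have : Module.Finite K (line c X).V := inferInstanceAs (Module.Finite K K)
    have hpos : 0 < Module.finrank K U :=
      Nat.pos_of_ne_zero fun h0 => hU (Submodule.finrank_eq_zero.1 h0)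
    have hx : Module.finrank K ↥((line c X).x c ⊓ U) ≤ Module.finrank K U :=
      Submodule.finrank_mono inf_le_right
    have hy : Module.finrank K ↥((line c X).y c ⊓ U) ≤ Module.finrank K U :=
      Submodule.finrank_mono inf_le_right
    rw [Finset.sum_eq_single c _ fun hc => absurd (Finset.mem_univ c) hc]
    · omega
    · intro i _ hic
      rw [line_x_of_ne hic, line_y_of_ne hic, bot_inf_eq, finrank_bot, add_zero]

theorem bot_ne_top_line_tower (n : ℕ) : (⊥ : Submodule K ((line c X).tower n).V) ≠ ⊤ :=
  have := ((line_isNegative c X).tower n).nontrivial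
  bot_ne_top

variable {c X} {t : Fin 3}

theorem ev_line_tower_cumX_of_ne (htc : t ≠ c) (n : ℕ) :
    ((line c X).tower n).ev (cumX t n) = ⊥ :=
  ev_tower_cumX_self_eq_bot (line_isNegative c X) (by simp [htc]) n

theorem ev_line_tower_cumY_succ_of_ne (htc : t ≠ c) (n : ℕ) :
    ((line c X).tower n).ev (cumY t (n + 1)) = ⊥ := by
  refine ev_tower_sup_eq_bot (line_isNegative c X) isElementary_e one_pos ?_ n
  change (line c X).ev (cumY t 1) = ⊥
  simp [cumY_one, htc]

theorem ev_line_tower_cumX_succ_of_ne (htc : t ≠ c) (n : ℕ) :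
    ((line c X).tower n).ev (cumX t (n + 1)) = ⊥ :=
  le_bot_iff.1 <| (OrderHomClass.mono ((line c X).tower n).ev (cumX_le_cumY t (n + 1))).trans
    (ev_line_tower_cumY_succ_of_ne htc n).le

theorem ev_line_e_of_len_eq_two (σ : Equiv.Perm (Fin 3)) :
    (line c X).ev (e (σ 0) (σ 1) (σ 2) 0 0 8) = ⊥ := by
  have hσ := tri_perm σ
  have he : e (σ 0) (σ 1) (σ 2) 0 0 8 = y (σ 1) ⊓ (x (σ 0) ⊔ y (σ 2)) := by
    simp [e_eq, eEven, a_zero, A_zero, a_succ hσ.rot.rot.swap]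
  rw [he, map_inf, map_sup, ev_y, ev_x, ev_y]
  by_cases h₁ : σ 1 = c
  · rw [line_x_of_ne fun h₀ => hσ.1 (h₀.trans h₁.symm),
      line_y_of_ne fun h₂ => hσ.2.1 (h₁.trans h₂.symm), sup_bot_eq, inf_bot_eq]
  · rw [line_y_of_ne h₁, bot_inf_eq]

theorem ev_line_tower_cumY_add_two (t : Fin 3) (n : ℕ) :
    ((line c X).tower n).ev (cumY t (n + 2)) = ⊥ := by
  refine ev_tower_sup_eq_bot (line_isNegative c X) isElementary_e two_pos ?_ n
  rw [ev_finset_sup (line_isNegative c X).disjoint_x, Finset.sup_eq_bot_iff]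
  rintro ⟨σ, r, k, p⟩ hs
  obtain ⟨-, -, hk, hlen⟩ := mem_params.1 hs
  obtain ⟨rfl, rfl, rfl⟩ := eq_of_len_eq_two hk hlen
  exact ev_line_e_of_len_eq_two σ

theorem ev_line_tower_cumY_self (n : ℕ) : ((line c X).tower n).ev (cumY c (n + 1)) = ⊤ := by
  refine ev_tower_sup_eq_top (line_isNegative c X) isElementary_e ?_ n
  change (line c X).ev (cumY c 1) = ⊤
  simp [cumY_one]

theorem ev_line_top_tower_cumX_self (n : ℕ) :
    ((line c (⊤ : Submodule K K)).tower n).ev (cumX c (n + 1)) = ⊤ := by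
  refine ev_tower_sup_eq_top (line_isNegative c ⊤) isElementary_f ?_ n
  change (line c ⊤).ev (cumX c 1) = ⊤
  simp [cumX_one]

theorem ev_line_bot_tower_cumX_self (n : ℕ) :
    ((line c (⊥ : Submodule K K)).tower n).ev (cumX c (n + 1)) = ⊥ := by
  refine ev_tower_sup_eq_bot (line_isNegative c ⊥) isElementary_f one_pos ?_ n
  change (line c ⊥).ev (cumX c 1) = ⊥
  simp [cumX_one]

end Line

/-! ### The chains -/

/-- The contribution `x_t(n) + y_t(n + 1)` of the index `t` to the elements `a_i(n)`. -/
def summand (n : ℕ) (t : Fin 3) : D222 := cumX t n ⊔ cumY t (n + 1)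

theorem erase_eq (i : Fin 3) : Finset.univ.erase i = {i + 1, i + 2} := by revert i; decide

theorem genA_eq_sup_erase (n : ℕ) (i : Fin 3) :
    genA n i = (Finset.univ.erase i).sup (summand n) := by
  rw [erase_eq, Finset.sup_insert, Finset.sup_singleton]
  cases n with
  | zero => simp only [genA, summand, cumX_zero, zero_add, cumY_one, bot_sup_eq]
  | succ n => rw [genA, summand, summand, sup_sup_sup_comm, sup_assoc]

theorem genB_eq_genA_sup (n : ℕ) (i : Fin 3) : genB n i = genA n i ⊔ cumX i (n + 1) := by
  cases n with
  | zero => rw [cumX_one, genB, genA, sup_assoc, sup_comm]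
  | succ n => rfl

theorem genC_eq_genA_sup (n : ℕ) (i : Fin 3) : genC n i = genA n i ⊔ cumY i (n + 1) := by
  cases n with
  | zero =>
    have huniv : insert i {i + 1, i + 2} = ({0, 1, 2} : Finset (Fin 3)) := by revert i; decide
    have := congrArg (Finset.sup · y) huniv
    simpa [genC, genA, cumY_one, sup_assoc, sup_comm, sup_left_comm] using this.symm
  | succ n => rfl

theorem unit_eq_sup (n : ℕ) : unit n = Finset.univ.sup (summand n) := by
  have hunit : unit n = Finset.univ.sup (genA n) := by
    simp [unit, Fin.univ_succ, sup_assoc]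
  rw [hunit]
  refine le_antisymm (Finset.sup_le fun i _ => ?_) (Finset.sup_le fun t _ => ?_)
  · rw [genA_eq_sup_erase]
    exact Finset.sup_mono (Finset.erase_subset i _)
  · have ht : summand n t ≤ genA n (t + 1) := by
      rw [genA_eq_sup_erase]
      exact Finset.le_sup (Finset.mem_erase.2 ⟨by simp, Finset.mem_univ t⟩)
    exact ht.trans (Finset.le_sup (Finset.mem_univ (t + 1)))

theorem genA_sup_summand (n : ℕ) (i : Fin 3) : genA n i ⊔ summand n i = unit n := by
  rw [genA_eq_sup_erase, unit_eq_sup, sup_comm, ← Finset.sup_insert,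
    Finset.insert_erase (Finset.mem_univ i)]

theorem genC_zero (i : Fin 3) : genC 0 i = unit 0 := by
  rw [genC_eq_genA_sup, ← genA_sup_summand 0 i, summand, cumX_zero, bot_sup_eq]

theorem coindependent_genA (n : ℕ) : Coindependent (genA n) (unit n) := by
  rw [unit_eq_sup, funext (genA_eq_sup_erase n)]
  exact coindependent_sup_erase (summand n)

section Line

variable {K : Type*} [DivisionRing K] {X : Submodule K K} (n : ℕ) (i : Fin 3)

theorem ev_line_tower_genA : ((line i X).tower n).ev (genA n i) = ⊥ := by
  rw [genA_eq_sup_erase, ev_finset_sup ((line_isNegative i X).tower n).disjoint_x,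
    Finset.sup_eq_bot_iff]
  intro t ht
  have hti := Finset.ne_of_mem_erase ht
  rw [summand, map_sup, ev_line_tower_cumX_of_ne hti, ev_line_tower_cumY_succ_of_ne hti, bot_sup_eq]

theorem ev_line_tower_genC_succ : ((line i X).tower n).ev (genC (n + 1) i) = ⊥ := by
  rw [genC_eq_genA_sup, genA_eq_sup_erase, map_sup, ev_line_tower_cumY_add_two,
    ev_finset_sup ((line_isNegative i X).tower n).disjoint_x, sup_bot_eq, Finset.sup_eq_bot_iff]
  intro t ht
  rw [summand, map_sup, ev_line_tower_cumX_succ_of_ne (Finset.ne_of_mem_erase ht),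
    ev_line_tower_cumY_add_two, bot_sup_eq]

end Line

theorem genA_lt_genB (n : ℕ) (i : Fin 3) : genA n i < genB n i := by
  refine lt_of_le_of_ne (genB_eq_genA_sup n i ▸ le_sup_left) fun h =>
    bot_ne_top_line_tower i (⊤ : Submodule ℚ ℚ) n ?_
  rw [← ev_line_tower_genA n i, h, genB_eq_genA_sup, map_sup, ev_line_top_tower_cumX_self,
    sup_top_eq]

theorem genB_lt_genC (n : ℕ) (i : Fin 3) : genB n i < genC n i := by
  refine lt_of_le_of_ne ?_ fun h => bot_ne_top_line_tower i (⊥ : Submodule ℚ ℚ) n ?_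
  · rw [genB_eq_genA_sup, genC_eq_genA_sup]
    exact sup_le_sup_left (cumX_le_cumY i (n + 1)) _
  · have hB : ((line i (⊥ : Submodule ℚ ℚ)).tower n).ev (genB n i) = ⊥ := by
      rw [genB_eq_genA_sup, map_sup, ev_line_tower_genA, ev_line_bot_tower_cumX_self, sup_bot_eq]
    rw [← hB, h, genC_eq_genA_sup, map_sup, ev_line_tower_cumY_self, sup_top_eq]

theorem genC_lt_unit (n : ℕ) (i : Fin 3) : genC (n + 1) i < unit (n + 1) := by
  refine lt_of_le_of_ne ?_ fun h => bot_ne_top_line_tower i (⊤ : Submodule ℚ ℚ) n ?_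
  · rw [genC_eq_genA_sup, ← genA_sup_summand (n + 1) i]
    exact sup_le_sup_left le_sup_right _
  · rw [← ev_line_tower_genC_succ n i, h, ← genA_sup_summand (n + 1) i, summand, map_sup, map_sup,
      ev_line_top_tower_cumX_self, top_sup_eq, sup_top_eq]

theorem chain4_succ_strictMono (n : ℕ) (i : Fin 3) : StrictMono (chain4 (n + 1) i) := by
  rw [Fin.strictMono_iff_lt_succ]
  intro b
  fin_cases b
  exacts [genA_lt_genB (n + 1) i, genB_lt_genC (n + 1) i, genC_lt_unit n i]

theorem chain3_strictMono (i : Fin 3) : StrictMono (chain3 i) := by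
  rw [Fin.strictMono_iff_lt_succ]
  intro b
  fin_cases b
  exacts [genA_lt_genB 0 i, genB_lt_genC 0 i]

theorem coindependentChains_chain4 (n : ℕ) :
    CoindependentChains (chain4 (n + 1)) (unit (n + 1)) where
  strictMono := chain4_succ_strictMono n
  apply_top _ := rfl
  coindependent := coindependent_genA (n + 1)

theorem coindependentChains_chain3 : CoindependentChains chain3 (unit 0) where
  strictMono := chain3_strictMono
  apply_top := genC_zero
  coindependent := coindependent_genA 0

theorem gen_le_iff {S : Set D222} {S' : Sublattice D222} : gen S ≤ S' ↔ S ⊆ S' :=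
  ⟨subset_latticeClosure.trans, fun h => latticeClosure_min h S'.isSublattice⟩

theorem H_succ_le_iff {n : ℕ} {S : Sublattice D222} : H (n + 1) ≤ S ↔
    (∀ i, genA (n + 1) i ∈ S) ∧ (∀ i, genB (n + 1) i ∈ S) ∧ ∀ i, genC (n + 1) i ∈ S := by
  simp only [H, gen_le_iff, Set.union_subset_iff, Set.range_subset_iff, SetLike.mem_coe, and_assoc]

theorem H_zero_le_iff {S : Sublattice D222} :
    H 0 ≤ S ↔ (∀ i, genA 0 i ∈ S) ∧ ∀ i, genB 0 i ∈ S := by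
  simp only [H, gen_le_iff, Set.union_subset_iff, Set.range_subset_iff, SetLike.mem_coe]

theorem unit_mem {n : ℕ} {S : Sublattice D222} (h : ∀ i, genA n i ∈ S) : unit n ∈ S :=
  S.supClosed (S.supClosed (h 0) (h 1)) (h 2)

theorem isLeast_H_succ (n : ℕ) :
    IsLeast {S : Sublattice D222 | ∀ i b, chain4 (n + 1) i b ∈ S} (H (n + 1)) := by
  refine ⟨fun i b => ?_, fun S h => H_succ_le_iff.2 ⟨(h · 0), (h · 1), (h · 2)⟩⟩
  obtain ⟨hA, hB, hC⟩ := H_succ_le_iff.1 (le_refl (H (n + 1)))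
  fin_cases b
  exacts [hA i, hB i, hC i, unit_mem hA]

theorem isLeast_H_zero : IsLeast {S : Sublattice D222 | ∀ i b, chain3 i b ∈ S} (H 0) := by
  refine ⟨fun i b => ?_, fun S h => H_zero_le_iff.2 ⟨(h · 0), (h · 1)⟩⟩
  obtain ⟨hA, hB⟩ := H_zero_le_iff.1 (le_refl (H 0))
  fin_cases b
  exacts [hA i, hB i, (genC_zero i ▸ unit_mem hA : genC 0 i ∈ H 0)]

theorem exists_orderIso_H_succ (n : ℕ) :
    ∃ φ : (Fin 3 → Fin 4) ≃o H (n + 1), ∀ v : Fin 3 → Fin 4, (φ v : D222) =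
      chain4 (n + 1) 0 (v 0) ⊓ chain4 (n + 1) 1 (v 1) ⊓ chain4 (n + 1) 2 (v 2) := by
  obtain ⟨φ, hφ⟩ := (coindependentChains_chain4 n).exists_orderIso (isLeast_H_succ n)
  exact ⟨φ, fun v => by simp [hφ, Fin.univ_succ, inf_assoc]⟩

theorem exists_orderIso_H_zero :
    ∃ φ : (Fin 3 → Fin 3) ≃o H 0, ∀ v : Fin 3 → Fin 3, (φ v : D222) =
      chain3 0 (v 0) ⊓ chain3 1 (v 1) ⊓ chain3 2 (v 2) := by
  obtain ⟨φ, hφ⟩ := coindependentChains_chain3.exists_orderIso isLeast_H_zero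
  exact ⟨φ, fun v => by simp [hφ, Fin.univ_succ, inf_assoc]⟩

theorem inf_sup_left_of_orderIso {L L' : Type*} [DistribLattice L] [Lattice L'] (φ : L ≃o L')
    (u v w : L') : u ⊓ (v ⊔ w) = (u ⊓ v) ⊔ (u ⊓ w) := by
  apply φ.symm.injective
  simp only [map_inf, map_sup, inf_sup_left]

end D222

theorem mainTheorem4 :
    (∀ (n : ℕ) (u v w : D222.H n), u ⊓ (v ⊔ w) = (u ⊓ v) ⊔ (u ⊓ w)) ∧
    (∀ n : ℕ, 1 ≤ n →
      Nat.card (D222.H n) = 64 ∧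
      (∀ i, StrictMono (D222.chain4 n i)) ∧
      ∃ φ : (Fin 3 → Fin 4) ≃o D222.H n, ∀ v : Fin 3 → Fin 4,
        (φ v : D222) =
          D222.chain4 n 0 (v 0) ⊓ D222.chain4 n 1 (v 1) ⊓ D222.chain4 n 2 (v 2)) ∧
    (Nat.card (D222.H 0) = 27 ∧
      (∀ i, StrictMono (D222.chain3 i)) ∧
      ∃ φ : (Fin 3 → Fin 3) ≃o D222.H 0, ∀ v : Fin 3 → Fin 3,
        (φ v : D222) =
          D222.chain3 0 (v 0) ⊓ D222.chain3 1 (v 1) ⊓ D222.chain3 2 (v 2)) := by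
  refine ⟨fun n u v w => ?_, fun n hn => ?_, ?_, D222.chain3_strictMono,
    D222.exists_orderIso_H_zero⟩
  · rcases n with - | n
    · obtain ⟨φ, -⟩ := D222.exists_orderIso_H_zero
      exact D222.inf_sup_left_of_orderIso φ u v w
    · obtain ⟨φ, -⟩ := D222.exists_orderIso_H_succ n
      exact D222.inf_sup_left_of_orderIso φ u v w
  · obtain ⟨n, rfl⟩ := Nat.exists_eq_succ_of_ne_zero (Nat.one_le_iff_ne_zero.1 hn)
    refine ⟨?_, D222.chain4_succ_strictMono n, D222.exists_orderIso_H_succ n⟩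
    obtain ⟨φ, -⟩ := D222.exists_orderIso_H_succ n
    simp [← Nat.card_congr φ.toEquiv]
  · obtain ⟨φ, -⟩ := D222.exists_orderIso_H_zero
    simp [← Nat.card_congr φ.toEquiv]
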